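/- \textbf{Setting.} Let $(\Omega,\mathcal F,P)$ be a probability space with a filtration $(\mathcal F_u)_{u=0}^{T}$ such that $\mathcal F_0$ contains all $P$-negligible sets, and let $S_u$ be $\mathcal F_u$-measurable with values in $\mathbb R^m_+$ a.s. For a $\sigma$-algebra $\mathcal G$, a $\mathcal G$-normal integrand on $\mathbb R^k$ is a $\mathcal G\otimes\mathcal B(\mathbb R^k)$-measurable function $f:\Omega\times\mathbb R^k\to\mathbb R$ with $f(\omega,\cdot)$ lower semicontinuous for every $\omega$. The costs $C_u:\Omega\times\mathbb R^m\times\mathbb R^d\to\mathbb R$, $0\le u\le T$, $d\ge 1$, are $\mathcal F_u$-normal integrands in $(s,z)$ (for example deterministic lower semicontinuous functions) such that, for all $\omega$, $s\in\mathbb R^m_+$, $x\in\mathbb R^d$, $a\in\mathbb R$: $C_u(s,0)=0$; $C_u(s,x+ae_1)=C_u(s,x)+a$; $C_T(s,\cdot)$ is nondecreasing for the order of $\mathbb R^d_+$; and $|C_u(s,x)|\le h_u(s,x)$ with $h_u$ deterministic and continuous. Write $z^{(2)}=(z^2,\dots,z^d)$. For $\xi:\Omega\to\mathbb R^d$ and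 an $\mathcal F_t$-measurable $V_{t-1}:\Omega\to\mathbb R^d$ put $$\gamma_t^\xi(V_{t-1})=\operatorname*{ess\,inf}_{\mathcal F_t}\ \operatorname*{ess\,sup}_{\mathcal F_t}\Big(\xi^1+\sum_{u=t}^T C_u\big(S_u,(0,V_u^{(2)}-V_{u-1}^{(2)})\big)\Big),$$ the infimum being over all $V_t,\dots,V_{T-1}$ with $V_u$ an $\mathcal F_u$-measurable $\mathbb R^d$-valued random variable, with $V_T=\xi$. Here $\operatorname{ess\,sup}_{\mathcal F_t}$ ($\operatorname{ess\,inf}_{\mathcal F_t}$) of a family is the smallest (largest) $\mathcal F_t$-measurable $[-\infty,\infty]$-valued random variable that dominates (is dominated by) all its members a.s. Put, for $\mathcal F_t$-measurable $Z$, $$\theta^0_t(Z)=\operatorname*{ess\,sup}_{\mathcal F_t}\gamma^0_{t+1}(Z),\qquad D^0_t(S_t,0,Z)=C_t\big(S_t,(0,Z^{(2)})\big)+\theta^0_t(Z),$$ $$i_t=\inf_{z\in S^{d-1}(0,1)}D_t^0(S_t,0,z),\qquad S^{d-1}(0,1)=\{z\in\mathbb R^d: z^1=0,\ |z|=1\},$$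 where the infimum is understood as $\operatorname{ess\,inf}_{\mathcal F_t}$ of $D^0_t(S_t,0,Z)$ over the $\mathcal F_t$-measurable $Z$ with values in $S^{d-1}(0,1)$ a.s. (this is the pointwise infimum of any jointly measurable version of $D^0_t(S_t,0,\cdot)$). \textbf{Theorem.} Let $0\le t<T$ and suppose: (1) there is an increasing bijection $\delta:[0,\infty]\to[0,\infty]$ such that for every $u\in\{t,\dots,T\}$, $C_u$ is positively super $\delta$-homogeneous: $C_u(s,\lambda x)\ge\delta(\lambda)C_u(s,x)$ for all $\omega$, $\lambda\ge1$, $s\in\mathbb R^m_+$, $x\in\mathbb R^d$; (2) $C_t(s,\cdot)$ is super-additive for all $\omega$ and $s\in\mathbb R^m_+$, or sub-additive for all $\omega$ and $s\in\mathbb R^m_+$; (3) $\xi=g(S_T)$ with $g:\mathbb R^m\to\mathbb R^d_+$ continuous, and $\xi$ is hedgeable: there are $V_{-1}=xe_1$ with $x$ real-valued and $\mathcal F_0$-measurable, and $\mathcal F_u$-measurable $V_u$ ($0\le u\le T$), such that $C_u(S_u,V_u-V_{u-1})\le 0$ a.s. for $u=0,\dots,T$ and $V_T=\xi$ a.s.;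 (4) for every $u\in\{t,\dots,T-1\}$, the conditional support of $S_{u+1}$ given $\mathcal F_u$ (the smallest $\mathcal F_u$-graph-measurable random closed set containing $S_{u+1}$ a.s.) equals $\phi_u(S_u)$ a.s., where $\phi_u$ is a lower hemicontinuous set-valued map from $\mathbb R^m$ to $\mathbb R^m$ with compact values and $\phi_u(S_u)\subseteq\bar B(0,R_u(S_u))$ a.s. for some continuous $R_u:\mathbb R^m\to\mathbb R$; (5) there is an $\mathcal F_{t+1}$-normal integrand $\tilde\gamma_{t+1}^\xi$ on $\mathbb R^m\times\mathbb R^d$ with $\gamma_{t+1}^\xi(V_t)=\tilde\gamma_{t+1}^\xi(S_{t+1},V_t)$ a.s. for every $\mathcal F_t$-measurable $V_t:\Omega\to\mathbb R^d$; (6) $i_t>0$ a.s. Then there is an $\mathcal F_t$-normal integrand $\tilde\gamma_t^\xi$ on $\mathbb R^m\times\mathbb R^d$ such that $\gamma_t^\xi(V_{t-1})=\tilde\gamma_t^\xi(S_t,V_{t-1})$ a.s. for every $\mathcal F_t$-measurable $V_{t-1}:\Omega\to\mathbb R^d$. -/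

import Mathlib

open MeasureTheory Set Filter
open scoped ENNReal

/-! ### Conditional essential suprema and infima of families -/

section CondEss

variable {Ω : Type*}

/-- `Y` is the conditional essential supremum of the family `𝒳` given `m`: the smallest
`m`-measurable `[-∞, ∞]`-valued random variable dominating (a.s.) every member of `𝒳`. -/
structure IsCondEssSup (m : MeasurableSpace Ω) {mΩ : MeasurableSpace Ω} (P : Measure Ω) (𝒳 : Set (Ω → EReal))
    (Y : Ω → EReal) : Prop where
  measurable : Measurable[m] Y
  le : ∀ X ∈ 𝒳, ∀ᵐ ω ∂P, X ω ≤ Y ω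
  least : ∀ Z : Ω → EReal, Measurable[m] Z → (∀ X ∈ 𝒳, ∀ᵐ ω ∂P, X ω ≤ Z ω) →
    ∀ᵐ ω ∂P, Y ω ≤ Z ω

/-- `Y` is the conditional essential infimum of the family `𝒳` given `m`: the largest
`m`-measurable `[-∞, ∞]`-valued random variable dominated (a.s.) by every member of `𝒳`. -/
structure IsCondEssInf (m : MeasurableSpace Ω) {mΩ : MeasurableSpace Ω} (P : Measure Ω) (𝒳 : Set (Ω → EReal))
    (Y : Ω → EReal) : Prop where
  measurable : Measurable[m] Y
  le : ∀ X ∈ 𝒳, ∀ᵐ ω ∂P, Y ω ≤ X ω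
  greatest : ∀ Z : Ω → EReal, Measurable[m] Z → (∀ X ∈ 𝒳, ∀ᵐ ω ∂P, Z ω ≤ X ω) →
    ∀ᵐ ω ∂P, Z ω ≤ Y ω

theorem exists_isCondEssSup {m mΩ : MeasurableSpace Ω} (hm : m ≤ mΩ) (P : Measure Ω)
    [IsFiniteMeasure P] (𝒳 : Set (Ω → EReal)) : ∃ Y, IsCondEssSup m P 𝒳 Y := by
  let ψ : EReal → ℝ≥0∞ := fun x => (1 + EReal.exp x)⁻¹
  have hψ_anti : Antitone ψ := fun a b hab =>
    ENNReal.inv_le_inv.2 (add_le_add le_rfl (EReal.exp_monotone hab))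
  have hψ_le : ∀ x, ψ x ≤ 1 := fun x => ENNReal.inv_le_one.2 le_self_add
  have hψ_inj : ∀ a b, ψ a = ψ b → a = b := by
    intro a b hab
    have h1 : 1 + EReal.exp a = 1 + EReal.exp b := inv_injective hab
    exact EReal.exp_strictMono.injective ((ENNReal.add_right_inj ENNReal.one_ne_top).1 h1)
  have hψ_meas : Measurable ψ := hψ_anti.measurable
  let 𝒵 : Set (Ω → EReal) := {Z | Measurable[m] Z ∧ ∀ X ∈ 𝒳, ∀ᵐ ω ∂P, X ω ≤ Z ω}
  have hne : ((fun Z : Ω → EReal => ∫⁻ ω, ψ (Z ω) ∂P) '' 𝒵).Nonempty :=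
    ⟨_, fun _ => ⊤, ⟨measurable_const, fun X _ => Eventually.of_forall fun _ => le_top⟩, rfl⟩
  obtain ⟨u, -, hu_tend, hu_mem⟩ := exists_seq_tendsto_sSup hne (OrderTop.bddAbove _)
  choose Z hZ𝒵 hZu using hu_mem
  let Y : Ω → EReal := fun ω => ⨅ n, Z n ω
  have hY𝒵 : Y ∈ 𝒵 := by
    refine ⟨Measurable.iInf fun n => (hZ𝒵 n).1, fun X hX => ?_⟩
    filter_upwards [ae_all_iff.2 fun n => (hZ𝒵 n).2 X hX] with ω h using le_iInf h
  have hYmax : ∀ W ∈ 𝒵, ∫⁻ ω, ψ (W ω) ∂P ≤ ∫⁻ ω, ψ (Y ω) ∂P := by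
    intro W hW
    refine (le_sSup (mem_image_of_mem _ hW)).trans (le_of_tendsto' hu_tend fun n => ?_)
    rw [← hZu n]
    exact lintegral_mono fun ω => hψ_anti (iInf_le _ n)
  refine ⟨Y, hY𝒵.1, hY𝒵.2, fun W hWm hWX => ?_⟩
  have hV : (fun ω => min (Y ω) (W ω)) ∈ 𝒵 := by
    refine ⟨hY𝒵.1.min hWm, fun X hX => ?_⟩
    filter_upwards [hY𝒵.2 X hX, hWX X hX] with ω h1 h2 using le_min h1 h2
  have heq : (fun ω => ψ (Y ω)) =ᵐ[P] fun ω => ψ (min (Y ω) (W ω)) := by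
    refine ae_eq_of_ae_le_of_lintegral_le
      (Eventually.of_forall fun ω => hψ_anti (min_le_left _ _)) ?_
      (Measurable.aemeasurable (f := fun ω => ψ (min (Y ω) (W ω)))
        (hψ_meas.comp (hV.1.mono hm le_rfl))) (hYmax _ hV)
    refine ne_top_of_le_ne_top (measure_ne_top P univ) ?_
    calc ∫⁻ ω, ψ (Y ω) ∂P ≤ ∫⁻ _, 1 ∂P := lintegral_mono fun ω => hψ_le _
      _ = P univ := lintegral_one
  filter_upwards [heq] with ω h
  rw [hψ_inj _ _ h]
  exact min_le_right _ _

theorem exists_isCondEssInf {m mΩ : MeasurableSpace Ω} (hm : m ≤ mΩ) (P : Measure Ω)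
    [IsFiniteMeasure P] (𝒳 : Set (Ω → EReal)) : ∃ Y, IsCondEssInf m P 𝒳 Y := by
  obtain ⟨Y, hY⟩ := exists_isCondEssSup hm P ((fun X ω => -X ω) '' 𝒳)
  refine ⟨fun ω => -Y ω, hY.measurable.neg, fun X hX => ?_, fun Z hZ hZX => ?_⟩
  · filter_upwards [hY.le _ (mem_image_of_mem _ hX)] with ω h using EReal.neg_le.1 h
  · refine (hY.least (fun ω => -Z ω) hZ.neg ?_).mono fun ω h => EReal.le_neg_of_le_neg h
    rintro _ ⟨X, hX, rfl⟩
    filter_upwards [hZX X hX] with ω h using EReal.neg_le_neg_iff.2 h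

open Classical in
/-- A version of the conditional essential supremum of `𝒳` given `m` (unique up to null sets). -/
noncomputable def condEssSup (m : MeasurableSpace Ω) {mΩ : MeasurableSpace Ω} (P : Measure Ω)
    (𝒳 : Set (Ω → EReal)) : Ω → EReal :=
  if h : ∃ Y, IsCondEssSup m P 𝒳 Y then h.choose else fun _ => ⊤

open Classical in
/-- A version of the conditional essential infimum of `𝒳` given `m` (unique up to null sets). -/
noncomputable def condEssInf (m : MeasurableSpace Ω) {mΩ : MeasurableSpace Ω} (P : Measure Ω)
    (𝒳 : Set (Ω → EReal)) : Ω → EReal :=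
  if h : ∃ Y, IsCondEssInf m P 𝒳 Y then h.choose else fun _ => ⊥

theorem isCondEssSup_condEssSup {m mΩ : MeasurableSpace Ω} (hm : m ≤ mΩ) (P : Measure Ω)
    [IsFiniteMeasure P] (𝒳 : Set (Ω → EReal)) : IsCondEssSup m P 𝒳 (condEssSup m P 𝒳) := by
  have h := exists_isCondEssSup hm P 𝒳
  rw [condEssSup, dif_pos h]
  exact h.choose_spec

theorem isCondEssInf_condEssInf {m mΩ : MeasurableSpace Ω} (hm : m ≤ mΩ) (P : Measure Ω)
    [IsFiniteMeasure P] (𝒳 : Set (Ω → EReal)) : IsCondEssInf m P 𝒳 (condEssInf m P 𝒳) := by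
  have h := exists_isCondEssInf hm P 𝒳
  rw [condEssInf, dif_pos h]
  exact h.choose_spec

/-! ### Normal integrands and conditional supports -/

/-- `f : Ω × E → ℝ` is an `m`-normal integrand: it is `m ⊗ ℬ(E)`-measurable and lower
semicontinuous in `x ∈ E`. -/
structure IsNormalIntegrand {E : Type*} [TopologicalSpace E] [MeasurableSpace E] [BorelSpace E]
    (m : MeasurableSpace Ω) (f : Ω → E → ℝ) : Prop where
  measurable : Measurable[m.prod inferInstance] fun p : Ω × E => f p.1 p.2
  lowerSemicontinuous : ∀ ω, LowerSemicontinuous (f ω)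

/-- `A` is (a version of) the conditional support `supp_m X`: the smallest `m`-graph-measurable
random closed set that contains `X` almost surely. -/
structure IsCondSupport {E : Type*} [TopologicalSpace E] [MeasurableSpace E] [BorelSpace E]
    (m : MeasurableSpace Ω) {mΩ : MeasurableSpace Ω} (P : Measure Ω) (X : Ω → E) (A : Ω → Set E) : Prop where
  isClosed : ∀ ω, IsClosed (A ω)
  measurable_graph : MeasurableSet[m.prod inferInstance] {p : Ω × E | p.2 ∈ A p.1}
  mem : ∀ᵐ ω ∂P, X ω ∈ A ω
  least : ∀ B : Ω → Set E, (∀ ω, IsClosed (B ω)) →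
    MeasurableSet[m.prod inferInstance] {p : Ω × E | p.2 ∈ B p.1} →
    (∀ᵐ ω ∂P, X ω ∈ B ω) → ∀ᵐ ω ∂P, A ω ⊆ B ω

end CondEss

/-! ### The market model -/

/-- `(0, x⁽²⁾)`: the position `x` with its cash component (the first one) replaced by `0`. -/
noncomputable def dropCash {d : ℕ} [NeZero d] (x : EuclideanSpace ℝ (Fin d)) :
    EuclideanSpace ℝ (Fin d) :=
  x - EuclideanSpace.single 0 (x 0)

/-- A discrete-time market with dates `0, …, T` (dates beyond `T` play no role), given by a
complete filtration, the exogenous process `S` with values in `ℝ₊ᵐ`, and the cost process: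
`C t ω (s, z)` is the minimal amount of cash needed to buy the position `z ∈ ℝᵈ` at date `t`
when `S_t = s`. -/
structure CostMarket (Ω : Type*) [mΩ : MeasurableSpace Ω] (P : Measure Ω) (m d : ℕ)
    [NeZero d] where
  T : ℕ
  ℱ : Filtration ℕ mΩ
  S : ℕ → Ω → EuclideanSpace ℝ (Fin m)
  C : ℕ → Ω → EuclideanSpace ℝ (Fin m) × EuclideanSpace ℝ (Fin d) → ℝ
  /-- the negligible sets belong to `ℱ 0` -/
  complete : ∀ A : Set Ω, P A = 0 → MeasurableSet[ℱ 0] A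
  S_measurable : ∀ t ≤ T, Measurable[ℱ t] (S t)
  S_nonneg : ∀ t ≤ T, ∀ᵐ ω ∂P, ∀ i, 0 ≤ S t ω i
  C_normal : ∀ t ≤ T, IsNormalIntegrand (ℱ t) (C t)
  C_zero : ∀ t ≤ T, ∀ ω s, (∀ i, 0 ≤ s i) → C t ω (s, 0) = 0
  C_cash : ∀ t ≤ T, ∀ ω s, (∀ i, 0 ≤ s i) → ∀ x (a : ℝ),
    C t ω (s, x + EuclideanSpace.single 0 a) = C t ω (s, x) + a
  /-- `C_T` is increasing with respect to `ℝ₊ᵈ` -/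
  C_mono : ∀ ω s, (∀ i, 0 ≤ s i) → ∀ x y, (∀ i, x i ≤ y i) → C T ω (s, x) ≤ C T ω (s, y)
  /-- the costs are dominated by a deterministic continuous function -/
  C_bound : ∀ t ≤ T, ∃ h : EuclideanSpace ℝ (Fin m) × EuclideanSpace ℝ (Fin d) → ℝ,
    Continuous h ∧ ∀ ω s, (∀ i, 0 ≤ s i) → ∀ x, |C t ω (s, x)| ≤ h (s, x)

namespace CostMarket

variable {Ω : Type*} [mΩ : MeasurableSpace Ω] {P : Measure Ω} {m d : ℕ} [NeZero d]

/-- `C_t` is positively super `δ`-homogeneous, where `δ` is an increasing bijection of `[0, ∞]`. -/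
def SuperHomogeneous (M : CostMarket Ω P m d) (δ : ℝ≥0∞ ≃o ℝ≥0∞) (t : ℕ) : Prop :=
  ∀ ω s, (∀ i, 0 ≤ s i) → ∀ x, ∀ r : ℝ, 1 ≤ r →
    (δ (ENNReal.ofReal r)).toReal * M.C t ω (s, x) ≤ M.C t ω (s, r • x)

def SuperAdditive (M : CostMarket Ω P m d) (t : ℕ) : Prop :=
  ∀ ω s, (∀ i, 0 ≤ s i) → ∀ x y,
    M.C t ω (s, x) + M.C t ω (s, y) ≤ M.C t ω (s, x + y)

def SubAdditive (M : CostMarket Ω P m d) (t : ℕ) : Prop :=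
  ∀ ω s, (∀ i, 0 ≤ s i) → ∀ x y,
    M.C t ω (s, x + y) ≤ M.C t ω (s, x) + M.C t ω (s, y)

/-- The solvency set `G_t`: the positions `z` whose liquidation value `-C_t(S_t, -z)` is
nonnegative. -/
def solvency (M : CostMarket Ω P m d) (t : ℕ) (ω : Ω) : Set (EuclideanSpace ℝ (Fin d)) :=
  {z | 0 ≤ -M.C t ω (M.S t ω, -z)}

/-- The claim `ξ` is hedgeable: some portfolio process, starting from an initial cash endowment
`x e₁` at date `-1` (where `ℱ_{-1} = ℱ_0`), satisfies `V_t - V_{t-1} ∈ -G_t` a.s. at all dates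
and ends at `V_T = ξ`. -/
def Hedgeable (M : CostMarket Ω P m d) (ξ : Ω → EuclideanSpace ℝ (Fin d)) : Prop :=
  ∃ (x : Ω → ℝ) (V : ℕ → Ω → EuclideanSpace ℝ (Fin d)),
    Measurable[M.ℱ 0] x ∧ (∀ t ≤ M.T, Measurable[M.ℱ t] (V t)) ∧
    (∀ᵐ ω ∂P, -(V 0 ω - EuclideanSpace.single 0 (x ω)) ∈ M.solvency 0 ω) ∧
    (∀ t < M.T, ∀ᵐ ω ∂P, -(V (t + 1) ω - V t ω) ∈ M.solvency (t + 1) ω) ∧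
    ∀ᵐ ω ∂P, V M.T ω = ξ ω

/-- The payoff is `ξ = g(S_T)` with `g` continuous and `ℝ₊ᵈ`-valued, and it is hedgeable. -/
def PayoffAssumption (M : CostMarket Ω P m d) (ξ : Ω → EuclideanSpace ℝ (Fin d)) : Prop :=
  (∃ g : EuclideanSpace ℝ (Fin m) → EuclideanSpace ℝ (Fin d), Continuous g ∧
    (∀ s i, 0 ≤ g s i) ∧ ξ = fun ω => g (M.S M.T ω)) ∧ M.Hedgeable ξ

/-- `supp_{ℱ_t} S_{t+1} = φ(S_t)` for a lower hemicontinuous compact-valued `φ` with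
`φ(S_t) ⊆ B̄(0, R(S_t))` for some continuous function `R`. -/
def SupportAssumption (M : CostMarket Ω P m d) (t : ℕ) : Prop :=
  ∃ (φ : EuclideanSpace ℝ (Fin m) → Set (EuclideanSpace ℝ (Fin m)))
    (R : EuclideanSpace ℝ (Fin m) → ℝ) (A : Ω → Set (EuclideanSpace ℝ (Fin m))),
    LowerHemicontinuous φ ∧ (∀ s, IsCompact (φ s)) ∧ Continuous R ∧
    IsCondSupport (M.ℱ t) P (M.S (t + 1)) A ∧ (∀ᵐ ω ∂P, A ω = φ (M.S t ω)) ∧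
    ∀ᵐ ω ∂P, φ (M.S t ω) ⊆ Metric.closedBall 0 (R (M.S t ω))

/-- The strategies from date `t` on, indexed so that `U s = V_{s-1}` is the position held just
before trading at date `s`: `V_{t-1} = W`, `V_s` is `ℱ_s`-measurable for `t ≤ s < T`, and
`V_T = ξ`. Only the components other than cash matter below. -/
def strategies (M : CostMarket Ω P m d) (ξ : Ω → EuclideanSpace ℝ (Fin d)) (t : ℕ)
    (W : Ω → EuclideanSpace ℝ (Fin d)) : Set (ℕ → Ω → EuclideanSpace ℝ (Fin d)) :=
  {U | U t = W ∧ (∀ s, t ≤ s → s < M.T → Measurable[M.ℱ s] (U (s + 1))) ∧ U (M.T + 1) = ξ}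

/-- `ξ¹ + ∑_{s=t}^T C_s(S_s, (0, V_s⁽²⁾ - V_{s-1}⁽²⁾))`, where `V_s = U (s + 1)`. -/
noncomputable def totalCost (M : CostMarket Ω P m d) (ξ : Ω → EuclideanSpace ℝ (Fin d)) (t : ℕ)
    (U : ℕ → Ω → EuclideanSpace ℝ (Fin d)) (ω : Ω) : ℝ :=
  ξ ω 0 + ∑ s ∈ Finset.Icc t M.T, M.C s ω (M.S s ω, dropCash (U (s + 1) ω - U s ω))

/-- `γ_t^ξ(W)`: the infimum cost at date `t` to replicate `ξ` from the risky position
`(0, W⁽²⁾)`. -/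
noncomputable def minCost (M : CostMarket Ω P m d) (ξ : Ω → EuclideanSpace ℝ (Fin d)) (t : ℕ)
    (W : Ω → EuclideanSpace ℝ (Fin d)) : Ω → EReal :=
  condEssInf (M.ℱ t) P
    ((fun U => condEssSup (M.ℱ t) P {fun ω => ((M.totalCost ξ t U ω : ℝ) : EReal)}) ''
      M.strategies ξ t W)

/-- `θ_t^ξ(V) = ess sup_{ℱ_t} γ_{t+1}^ξ(V)`. -/
noncomputable def theta (M : CostMarket Ω P m d) (ξ : Ω → EuclideanSpace ℝ (Fin d)) (t : ℕ)
    (V : Ω → EuclideanSpace ℝ (Fin d)) : Ω → EReal :=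
  condEssSup (M.ℱ t) P {M.minCost ξ (t + 1) V}

/-- `D_t^ξ(S_t, W, V) = C_t(S_t, (0, V⁽²⁾ - W⁽²⁾)) + θ_t^ξ(V)`. -/
noncomputable def D (M : CostMarket Ω P m d) (ξ : Ω → EuclideanSpace ℝ (Fin d)) (t : ℕ)
    (W V : Ω → EuclideanSpace ℝ (Fin d)) (ω : Ω) : EReal :=
  ((M.C t ω (M.S t ω, dropCash (V ω - W ω)) : ℝ) : EReal) + M.theta ξ t V ω

/-- `inf_{z ∈ S^{d-1}(0,1)} D_t^0(S_t, 0, z)` with `S^{d-1}(0,1) = {z : z¹ = 0, |z| = 1}`. As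
`D_t^0(S_t, 0, ·)` acts on `ℱ_t`-measurable random positions and is determined up to null sets,
the infimum is the essential one over the `ℱ_t`-measurable `z` with values in the sphere. It is
the pointwise infimum over the sphere of any jointly measurable version of `D_t^0(S_t, 0, ·)`. -/
noncomputable def sphereInf (M : CostMarket Ω P m d) (t : ℕ) : Ω → EReal :=
  condEssInf (M.ℱ t) P
    ((fun Z => M.D 0 t 0 Z) '' {Z : Ω → EuclideanSpace ℝ (Fin d) |
      Measurable[M.ℱ t] Z ∧ ∀ᵐ ω ∂P, Z ω 0 = 0 ∧ ‖Z ω‖ = 1})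

end CostMarket

open scoped Topology

/-! ### Measurable extraction of subsequences -/

section Extraction

variable {Ω E : Type*}

/-! The cost `γ_t` is treated as a functional of random positions, and normality is recovered only
at the end. By dynamic programming (`isCondEssInf_minCost`), `γ_t(V)` is the essential infimum over
`ℱ_t`-measurable `Z` of `D_t(V, Z) = C_t(S_t, (0, Z⁽²⁾ - V⁽²⁾)) + θ_t(Z)`. A normal representation
of `γ_{t+1}` makes `θ_t` local and lower semicontinuous.

The missing compactness comes from `i_t > 0` (`exists_coercive`). Cash invariance turns
super-homogeneity into `r C ≤ C(r ·)`, this scaling passes to `θ_t^0`, and `θ_t^0 ≤ θ_t^ξ` because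
`ξ ≥ 0` and `C_T` is monotone. Super- or sub-additivity then replaces the starting position `0` by
`V` at the price of a continuous error. So `D_t(V, ·)` grows at least linearly in the risky
position. Near-optimal positions for a convergent sequence `W_n → V` with costs bounded above are
therefore pointwise bounded. A measurable random subsequence converges, and its limit is good enough
for `V` (`exists_D_le_of_tendsto`). Hence `γ_t` is local, lower semicontinuous and never `-∞`.

Conditional boundedness of future prices bounds `γ_t` above by a finite normal integrand.
`IsLocalLSC.exists_isNormalIntegrand` then builds the representation from essential infima over a
countable base of balls. -/

theorem Measurable.comp_index {mΩ : MeasurableSpace Ω} [MeasurableSpace E] {X : ℕ → Ω → E}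
    (hX : ∀ n, Measurable (X n)) {N : Ω → ℕ} (hN : Measurable N) :
    Measurable fun ω => X (N ω) ω :=
  (measurable_from_prod_countable_right (f := fun p : ℕ × Ω => X p.1 p.2) hX).comp
    (hN.prodMk measurable_id)

theorem measurableSet_frequently {mΩ : MeasurableSpace Ω} {p : ℕ → Ω → Prop}
    (hp : ∀ n, MeasurableSet {ω | p n ω}) : MeasurableSet {ω | ∃ᶠ n in atTop, p n ω} := by
  simp only [frequently_atTop, ofPred_forall]
  refine MeasurableSet.iInter fun k => ?_
  have : {ω | ∃ n ≥ k, p n ω} = ⋃ n, ⋃ _ : n ≥ k, {ω | p n ω} := by ext; simp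
  rw [this]
  exact MeasurableSet.iUnion fun n => MeasurableSet.iUnion fun _ => hp n

theorem exists_measurable_first {mΩ : MeasurableSpace Ω} {p : ℕ → Ω → Prop}
    (hp : ∀ n, MeasurableSet {ω | p n ω}) :
    ∃ N : Ω → ℕ, Measurable N ∧ ∀ ω, (∃ n, p n ω) → p (N ω) ω := by
  classical
  -- The second alternative makes the search total: it returns `0` where no index works.
  have hex : ∀ ω : Ω, ∃ n, p n ω ∨ ω ∈ (⋃ l, {ω | p l ω})ᶜ := by
    intro ω
    by_cases h : ∃ n, p n ω
    · exact h.imp fun _ => Or.inl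
    · exact ⟨0, Or.inr (by simpa using h)⟩
  refine ⟨fun ω => Nat.find (hex ω), measurable_find hex fun n =>
    (hp n).union (MeasurableSet.iUnion hp).compl, fun ω h => ?_⟩
  exact (Nat.find_spec (hex ω)).resolve_right (by simpa using h)

theorem exists_measurable_index {mΩ : MeasurableSpace Ω} {p : ℕ → Ω → Prop}
    (hp : ∀ n, MeasurableSet {ω | p n ω}) :
    ∃ N : ℕ → Ω → ℕ, (∀ k, Measurable (N k)) ∧ (∀ k ω, k ≤ N k ω) ∧
      ∀ ω, (∃ᶠ n in atTop, p n ω) → ∀ k, p (N k ω) ω := by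
  choose N hN hNp using fun k : ℕ => exists_measurable_first (p := fun n ω => k ≤ n ∧ p n ω)
    fun n => (MeasurableSet.const _).inter (hp n)
  refine ⟨fun k ω => max k (N k ω), fun k => measurable_const.max (hN k),
    fun k ω => le_max_left _ _, fun ω h k => ?_⟩
  have h1 := hNp k ω (frequently_atTop.1 h k)
  simpa only [max_eq_right h1.1] using h1.2

variable [NormedAddCommGroup E] [ProperSpace E] [MeasurableSpace E] [BorelSpace E]

/-- One step of a random Bolzano–Weierstrass argument, with `p` a random infinite set of indices.
Some ball of radius `ε / 2` around a point of a dense sequence is visited infinitely often; taking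
the first such centre keeps the choice measurable. -/
theorem exists_frequently_refinement {mΩ : MeasurableSpace Ω} {X : ℕ → Ω → E}
    (hX : ∀ n, Measurable (X n)) (hb : ∀ ω, ∃ R : ℝ, ∀ n, ‖X n ω‖ ≤ R) {ε : ℝ} (hε : 0 < ε)
    {p : ℕ → Ω → Prop} (hp : ∀ n, MeasurableSet {ω | p n ω})
    (hfreq : ∀ ω, ∃ᶠ n in atTop, p n ω) :
    ∃ p' : ℕ → Ω → Prop, (∀ n, MeasurableSet {ω | p' n ω}) ∧ (∀ ω, ∃ᶠ n in atTop, p' n ω) ∧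
      (∀ n ω, p' n ω → p n ω) ∧
      ∀ n l ω, p' n ω → p' l ω → dist (X n ω) (X l ω) < ε := by
  classical
  let c := TopologicalSpace.denseSeq E
  have hmeas : ∀ j n, MeasurableSet {ω | p n ω ∧ dist (X n ω) (c j) < ε / 2} := fun j n =>
    (hp n).inter (measurableSet_lt ((hX n).dist measurable_const) measurable_const)
  have hex : ∀ ω, ∃ j, ∃ᶠ n in atTop, p n ω ∧ dist (X n ω) (c j) < ε / 2 := by
    intro ω
    obtain ⟨R, hR⟩ := hb ω
    have hne : (atTop ⊓ 𝓟 {n | p n ω}).NeBot := frequently_mem_iff_neBot.1 (hfreq ω)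
    obtain ⟨a, -, ha⟩ := (isCompact_closedBall (0 : E) R).exists_mapClusterPt_of_frequently
      (l := atTop ⊓ 𝓟 {n | p n ω}) (f := fun n => X n ω)
      (Eventually.of_forall fun n => by simpa using hR n).frequently
    obtain ⟨j, hj⟩ := (TopologicalSpace.denseRange_denseSeq E).exists_dist_lt a
      (half_pos (half_pos hε))
    refine ⟨j, ?_⟩
    have h1 := mapClusterPt_iff_frequently.1 ha _ (Metric.ball_mem_nhds a (half_pos (half_pos hε)))
    refine (frequently_inf_principal.1 h1).mono fun n hn => ⟨hn.1, ?_⟩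
    calc dist (X n ω) (c j) ≤ dist (X n ω) a + dist a (c j) := dist_triangle _ _ _
      _ < ε / 2 / 2 + ε / 2 / 2 := add_lt_add hn.2 hj
      _ = ε / 2 := add_halves _
  refine ⟨fun n ω => p n ω ∧ dist (X n ω) (c (Nat.find (hex ω))) < ε / 2, fun n => ?_,
    fun ω => Nat.find_spec (hex ω), fun n ω h => h.1, fun n l ω h1 h2 => ?_⟩
  · have hJ : Measurable fun ω => Nat.find (hex ω) :=
      measurable_find hex fun j => measurableSet_frequently (hmeas j)
    exact (hp n).inter (measurableSet_lt
      ((hX n).dist ((measurable_of_countable c).comp hJ)) measurable_const)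
  · calc dist (X n ω) (X l ω) ≤ dist (X n ω) (c (Nat.find (hex ω)))
        + dist (X l ω) (c (Nat.find (hex ω))) := dist_triangle_right _ _ _
      _ < ε / 2 + ε / 2 := add_lt_add h1.2 h2.2
      _ = ε := add_halves ε

/-- Diagonal extraction through nested random index sets of diameter below `1 / (k + 1)`. The bound
may depend on `ω` in any way, measurable or not. -/
theorem exists_measurable_subseq_of_bounded {mΩ : MeasurableSpace Ω} {X : ℕ → Ω → E}
    (hX : ∀ n, Measurable (X n)) (hb : ∀ ω, ∃ R : ℝ, ∀ n, ‖X n ω‖ ≤ R) :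
    ∃ (N : ℕ → Ω → ℕ) (Y : Ω → E), (∀ k, Measurable (N k)) ∧ (∀ k ω, k ≤ N k ω) ∧ Measurable Y ∧
      ∀ ω, Tendsto (fun k => X (N k ω) ω) atTop (𝓝 (Y ω)) := by
  let 𝒬 := {p : ℕ → Ω → Prop // (∀ n, MeasurableSet {ω | p n ω}) ∧ ∀ ω, ∃ᶠ n in atTop, p n ω}
  have hstep : ∀ (k : ℕ) (p : 𝒬), ∃ p' : 𝒬, (∀ n ω, p'.1 n ω → p.1 n ω) ∧
      ∀ n l ω, p'.1 n ω → p'.1 l ω → dist (X n ω) (X l ω) < 1 / ((k : ℝ) + 1) := by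
    intro k p
    obtain ⟨p', h1, h2, h3, h4⟩ := exists_frequently_refinement hX hb
      (Nat.one_div_pos_of_nat (n := k)) p.2.1 p.2.2
    exact ⟨⟨p', h1, h2⟩, h3, h4⟩
  choose step hle hdist using hstep
  let q : ℕ → 𝒬 := fun k => Nat.rec
    ⟨fun _ _ => True, fun _ => MeasurableSet.univ, fun _ => Frequently.of_forall fun _ => trivial⟩
    step k
  have hq : ∀ k, q (k + 1) = step k (q k) := fun _ => rfl
  have hanti : ∀ k l, k ≤ l → ∀ n ω, (q l).1 n ω → (q k).1 n ω := by
    intro k l hkl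
    induction l, hkl using Nat.le_induction with
    | base => exact fun _ _ h => h
    | succ l _ ih => exact fun n ω h => ih n ω (hle l (q l) n ω (hq l ▸ h))
  have hidx := fun k => exists_measurable_index (q (k + 1)).2.1
  choose N hNm hNle hNq using hidx
  have hmem : ∀ k ω, (q (k + 1)).1 (N k k ω) ω := fun k ω => hNq k ω ((q (k + 1)).2.2 ω) k
  have hcauchy : ∀ ω, CauchySeq fun k => X (N k k ω) ω := by
    intro ω
    refine cauchySeq_of_le_tendsto_0' (fun k : ℕ => 1 / ((k : ℝ) + 1)) (fun k l hkl => ?_)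
      tendsto_one_div_add_atTop_nhds_zero_nat
    exact (hdist k (q k) _ _ ω (hmem k ω)
      (hanti (k + 1) (l + 1) (by omega) _ ω (hmem l ω))).le
  choose Y hY using fun ω => cauchySeq_tendsto_of_complete (hcauchy ω)
  have hXN : ∀ k, Measurable fun ω => X (N k k ω) ω := fun k => Measurable.comp_index hX (hNm k k)
  exact ⟨fun k => N k k, Y, fun k => hNm k k, fun k ω => hNle k k ω,
    measurable_of_tendsto_metrizable hXN (tendsto_pi_nhds.2 hY), hY⟩

end Extraction

/-! ### Conditional essential bounds -/

section CondEssLemmas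

variable {Ω : Type*} {m mΩ : MeasurableSpace Ω} {P : Measure Ω}

/-- Exhaustion: pasting a maximizing sequence gives a `k` for which `P(F k < q)` is maximal. No
member can then go below `q` outside `{F k < q}`, since pasting it with `F k` would increase this
probability. A single member thus beats `q` wherever the infimum does. -/
theorem exists_lt_of_isCondEssInf {ι : Type*} [Nonempty ι] [IsFiniteMeasure P] (hm : m ≤ mΩ)
    {F : ι → Ω → EReal} (hF : ∀ i, Measurable[m] (F i))
    (hpaste : ∀ (u : ℕ → ι) (N : Ω → ℕ), Measurable[m] N →
      ∃ k, ∀ᵐ ω ∂P, F k ω = F (u (N ω)) ω)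
    {Y : Ω → EReal} (hY : IsCondEssInf m P (range F) Y) {q : Ω → EReal} (hq : Measurable[m] q) :
    ∃ k, ∀ᵐ ω ∂P, Y ω < q ω → F k ω < q ω := by
  classical
  let c : ι → ℝ≥0∞ := fun i => P {ω | F i ω < q ω}
  obtain ⟨v, -, hv_tend, hv_mem⟩ :=
    exists_seq_tendsto_sSup (range_nonempty c) (OrderTop.bddAbove _)
  choose u hu using hv_mem
  have hmeas : ∀ i, MeasurableSet[m] {ω | F i ω < q ω} := fun i => measurableSet_lt (hF i) hq
  obtain ⟨N, hN, hNspec⟩ := exists_measurable_first fun n => hmeas (u n)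
  obtain ⟨k, hk⟩ := hpaste u N hN
  have hkmax : ∀ i, c i ≤ c k := by
    intro i
    refine (le_sSup (mem_range_self i)).trans (le_of_tendsto' hv_tend fun n => ?_)
    rw [← hu n]
    refine measure_mono_ae ?_
    filter_upwards [hk] with ω h1 (h2 : F (u n) ω < q ω)
    change F k ω < q ω
    rw [h1]
    exact hNspec ω ⟨n, h2⟩
  refine ⟨k, ?_⟩
  -- Maximality makes this a lower bound of the whole family, hence at most `Y`.
  have hZ : Measurable[m] fun ω => if F k ω < q ω then ⊥ else q ω :=
    Measurable.ite (hmeas k) measurable_const hq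
  have hZle : ∀ i, ∀ᵐ ω ∂P, (if F k ω < q ω then ⊥ else q ω) ≤ F i ω := by
    intro i
    let N' : Ω → ℕ := fun ω => if F k ω < q ω then 0 else 1
    obtain ⟨l, hl⟩ := hpaste (fun n => if n = 0 then k else i) N'
      (Measurable.ite (hmeas k) measurable_const measurable_const)
    have hsub : ∀ᵐ ω ∂P, F k ω < q ω → F l ω < q ω := by
      filter_upwards [hl] with ω h1 h2
      rw [h1]
      simp [N', h2]
    have heq : {ω | F k ω < q ω} =ᵐ[P] {ω | F l ω < q ω} :=
      ae_eq_of_ae_subset_of_measure_ge hsub (hkmax l)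
        (hm _ (hmeas k)).nullMeasurableSet (measure_ne_top _ _)
    filter_upwards [heq.mem_iff, hl] with ω h1 h2
    split_ifs with h3
    · exact bot_le
    · by_contra! h4
      refine h3 (h1.2 ?_)
      rw [h2]
      simpa [N', h3] using h4
  have := hY.greatest _ hZ (by rintro _ ⟨i, rfl⟩; exact hZle i)
  filter_upwards [this] with ω h1 h2
  by_contra h3
  rw [if_neg h3] at h1
  exact absurd (h1.trans_lt h2) (lt_irrefl _)

end CondEssLemmas

/-! ### Locality of conditional essential bounds -/

section CondEssLocal

variable {Ω : Type*} {m mΩ : MeasurableSpace Ω} {P : Measure Ω}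

/-- Raising the bound to `⊤` off the `m`-measurable set `A` makes it a global competitor. -/
theorem condEssSup_singleton_le_on [IsFiniteMeasure P] (hm : m ≤ mΩ) {X Z : Ω → EReal}
    (hZ : Measurable[m] Z) {A : Set Ω} (hA : MeasurableSet[m] A)
    (h : ∀ᵐ ω ∂P, ω ∈ A → X ω ≤ Z ω) : ∀ᵐ ω ∂P, ω ∈ A → condEssSup m P {X} ω ≤ Z ω := by
  classical
  have h1 := (isCondEssSup_condEssSup hm P {X}).least (fun ω => if ω ∈ A then Z ω else ⊤)
    (Measurable.ite hA hZ measurable_const) (by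
      rintro _ rfl
      filter_upwards [h] with ω hω
      split_ifs with hωA
      exacts [hω hωA, le_top])
  filter_upwards [h1] with ω hω hωA
  simpa only [if_pos hωA] using hω

theorem le_condEssSup_singleton [IsFiniteMeasure P] (hm : m ≤ mΩ) (X : Ω → EReal) :
    ∀ᵐ ω ∂P, X ω ≤ condEssSup m P {X} ω :=
  (isCondEssSup_condEssSup hm P {X}).le X rfl

theorem measurable_condEssSup [IsFiniteMeasure P] (hm : m ≤ mΩ) (𝒳 : Set (Ω → EReal)) :
    Measurable[m] (condEssSup m P 𝒳) :=
  (isCondEssSup_condEssSup hm P 𝒳).measurable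

theorem measurable_condEssInf [IsFiniteMeasure P] (hm : m ≤ mΩ) (𝒳 : Set (Ω → EReal)) :
    Measurable[m] (condEssInf m P 𝒳) :=
  (isCondEssInf_condEssInf hm P 𝒳).measurable

theorem condEssSup_singleton_mono_on [IsFiniteMeasure P] (hm : m ≤ mΩ) {X X' : Ω → EReal}
    {A : Set Ω} (hA : MeasurableSet[m] A) (h : ∀ᵐ ω ∂P, ω ∈ A → X ω ≤ X' ω) :
    ∀ᵐ ω ∂P, ω ∈ A → condEssSup m P {X} ω ≤ condEssSup m P {X'} ω := by
  refine condEssSup_singleton_le_on hm (measurable_condEssSup hm _) hA ?_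
  filter_upwards [h, le_condEssSup_singleton hm X'] with ω h1 h2 hωA using (h1 hωA).trans h2

theorem condEssSup_singleton_mono [IsFiniteMeasure P] (hm : m ≤ mΩ) {X X' : Ω → EReal}
    (h : ∀ᵐ ω ∂P, X ω ≤ X' ω) : ∀ᵐ ω ∂P, condEssSup m P {X} ω ≤ condEssSup m P {X'} ω := by
  filter_upwards [condEssSup_singleton_mono_on hm MeasurableSet.univ
    (h.mono fun _ h _ => h)] with ω h using h trivial

theorem condEssSup_singleton_congr_on [IsFiniteMeasure P] (hm : m ≤ mΩ) {X X' : Ω → EReal}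
    {A : Set Ω} (hA : MeasurableSet[m] A) (h : ∀ᵐ ω ∂P, ω ∈ A → X ω = X' ω) :
    ∀ᵐ ω ∂P, ω ∈ A → condEssSup m P {X} ω = condEssSup m P {X'} ω := by
  filter_upwards [condEssSup_singleton_mono_on hm hA (h.mono fun _ h h' => (h h').le),
    condEssSup_singleton_mono_on hm hA (h.mono fun _ h h' => (h h').ge)] with ω h1 h2 hωA
  exact (h1 hωA).antisymm (h2 hωA)

theorem IsCondEssInf.le_on {𝒳 : Set (Ω → EReal)} {Y : Ω → EReal} (hY : IsCondEssInf m P 𝒳 Y)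
    {Z : Ω → EReal} (hZ : Measurable[m] Z) {A : Set Ω} (hA : MeasurableSet[m] A)
    (h : ∀ X ∈ 𝒳, ∀ᵐ ω ∂P, ω ∈ A → Z ω ≤ X ω) : ∀ᵐ ω ∂P, ω ∈ A → Z ω ≤ Y ω := by
  classical
  have h1 := hY.greatest (fun ω => if ω ∈ A then Z ω else ⊥)
    (Measurable.ite hA hZ measurable_const) (by
      intro X hX
      filter_upwards [h X hX] with ω hω
      split_ifs with hωA
      exacts [hω hωA, bot_le])
  filter_upwards [h1] with ω hω hωA
  simpa only [if_pos hωA] using hω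

theorem ae_eq_comp_index {F : ℕ → Ω → EReal} {G : Ω → EReal} (N : Ω → ℕ)
    (h : ∀ n, ∀ᵐ ω ∂P, N ω = n → G ω = F n ω) : ∀ᵐ ω ∂P, G ω = F (N ω) ω := by
  filter_upwards [ae_all_iff.2 h] with ω hω using hω _ rfl

theorem ae_eq_comp_index_of_congr_on {E : Type*} [MeasurableSpace E] {Φ : (Ω → E) → Ω → EReal}
    (h : ∀ V W, Measurable[m] V → Measurable[m] W → ∀ A, MeasurableSet[m] A →
      (∀ ω ∈ A, V ω = W ω) → ∀ᵐ ω ∂P, ω ∈ A → Φ V ω = Φ W ω)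
    {V : ℕ → Ω → E} (hV : ∀ n, Measurable[m] (V n)) {N : Ω → ℕ} (hN : Measurable[m] N) :
    ∀ᵐ ω ∂P, Φ (fun ω => V (N ω) ω) ω = Φ (V (N ω)) ω :=
  ae_eq_comp_index (F := fun n => Φ (V n)) N fun n =>
    h _ _ (Measurable.comp_index hV hN) (hV n) {ω | N ω = n}
      (hN (measurableSet_singleton n)) fun ω (hω : N ω = n) => by simp only [hω]

end CondEssLocal

/-! ### Local lower semicontinuous functionals of random variables -/

section LocalLSC

variable {Ω E : Type*} [TopologicalSpace E] [MeasurableSpace E]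

/-- `Φ` acts on `m`-measurable random variables, is local, and is sequentially lower
semicontinuous along pointwise convergent sequences. -/
structure IsLocalLSC (m : MeasurableSpace Ω) {mΩ : MeasurableSpace Ω} (P : Measure Ω)
    (Φ : (Ω → E) → Ω → EReal) : Prop where
  measurable : ∀ V, Measurable[m] V → Measurable[m] (Φ V)
  congr_on : ∀ V W, Measurable[m] V → Measurable[m] W → ∀ A, MeasurableSet[m] A →
    (∀ ω ∈ A, V ω = W ω) → ∀ᵐ ω ∂P, ω ∈ A → Φ V ω = Φ W ω
  le_liminf : ∀ (V : Ω → E) (W : ℕ → Ω → E), Measurable[m] V → (∀ n, Measurable[m] (W n)) →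
    (∀ ω, Tendsto (fun n => W n ω) atTop (𝓝 (V ω))) →
    ∀ᵐ ω ∂P, Φ V ω ≤ liminf (fun n => Φ (W n) ω) atTop

variable {m mΩ : MeasurableSpace Ω} {P : Measure Ω} {Φ : (Ω → E) → Ω → EReal}

namespace IsLocalLSC

theorem comp_index (h : IsLocalLSC m P Φ) {V : ℕ → Ω → E} (hV : ∀ n, Measurable[m] (V n))
    {N : Ω → ℕ} (hN : Measurable[m] N) :
    ∀ᵐ ω ∂P, Φ (fun ω => V (N ω) ω) ω = Φ (V (N ω)) ω :=
  ae_eq_comp_index_of_congr_on h.congr_on hV hN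

theorem le_of_tendsto (h : IsLocalLSC m P Φ) {V : Ω → E} {W : ℕ → Ω → E} (hV : Measurable[m] V)
    (hW : ∀ n, Measurable[m] (W n)) (hlim : ∀ ω, Tendsto (fun n => W n ω) atTop (𝓝 (V ω)))
    {A : Set Ω} {q : ℕ → Ω → EReal} {q' : Ω → EReal}
    (hq : ∀ ω, Tendsto (fun n => q n ω) atTop (𝓝 (q' ω)))
    (hle : ∀ n, ∀ᵐ ω ∂P, ω ∈ A → Φ (W n) ω ≤ q n ω) : ∀ᵐ ω ∂P, ω ∈ A → Φ V ω ≤ q' ω := by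
  filter_upwards [h.le_liminf V W hV hW hlim, ae_all_iff.2 hle] with ω h1 h2 hωA
  refine h1.trans ?_
  rw [← (hq ω).liminf_eq]
  exact liminf_le_liminf (Eventually.of_forall fun n => h2 n hωA)

theorem exists_lt_of_condEssInf_lt [IsFiniteMeasure P] (h : IsLocalLSC m P Φ) (hm : m ≤ mΩ)
    {B : Set E} (hB : B.Nonempty) {q : Ω → EReal} (hq : Measurable[m] q) :
    ∃ W, Measurable[m] W ∧ (∀ ω, W ω ∈ B) ∧
      ∀ᵐ ω ∂P, condEssInf m P (Φ '' {W | Measurable[m] W ∧ ∀ ω, W ω ∈ B}) ω < q ω → Φ W ω < q ω := by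
  have hne : Nonempty {W : Ω → E | Measurable[m] W ∧ ∀ ω, W ω ∈ B} :=
    ⟨⟨fun _ => hB.some, measurable_const, fun _ => hB.some_mem⟩⟩
  have hY := isCondEssInf_condEssInf hm P (Φ '' {W | Measurable[m] W ∧ ∀ ω, W ω ∈ B})
  nth_rw 1 [image_eq_range] at hY
  obtain ⟨⟨W, hW, hWB⟩, hlt⟩ := exists_lt_of_isCondEssInf hm
    (F := fun i : {W : Ω → E | Measurable[m] W ∧ ∀ ω, W ω ∈ B} => Φ i)
    (fun i => h.measurable _ i.2.1) (fun u N hN =>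
      ⟨⟨fun ω => (u (N ω)).1 ω, Measurable.comp_index (fun n => (u n).2.1) hN,
        fun ω => (u (N ω)).2.2 ω⟩, h.comp_index (fun n => (u n).2.1) hN⟩) hY hq
  exact ⟨W, hW, hWB, hlt⟩

end IsLocalLSC

end LocalLSC

/-! ### Representation of local functionals by normal integrands -/

section Representation

variable {Ω E : Type*} [NormedAddCommGroup E] [ProperSpace E] [MeasurableSpace E] [BorelSpace E]
  {m mΩ : MeasurableSpace Ω} {P : Measure Ω} {Φ : (Ω → E) → Ω → EReal}

/-- Where the infimum is `-∞`, there are `B`-valued `W n` with `Φ (W n) < -n`. A limit along a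
random subsequence, which may leave `B`, would have `Φ = -∞` there. -/
theorem IsLocalLSC.condEssInf_ne_bot [IsFiniteMeasure P] (h : IsLocalLSC m P Φ) (hm : m ≤ mΩ)
    (hbot : ∀ V, Measurable[m] V → ∀ᵐ ω ∂P, ⊥ < Φ V ω) {B : Set E} (hB : B.Nonempty)
    (hBb : Bornology.IsBounded B) :
    ∀ᵐ ω ∂P, condEssInf m P (Φ '' {W | Measurable[m] W ∧ ∀ ω, W ω ∈ B}) ω ≠ ⊥ := by
  choose W hW hWB hlt using fun n : ℕ =>
    h.exists_lt_of_condEssInf_lt hm hB (q := fun _ => ((-(n : ℝ) : ℝ) : EReal)) measurable_const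
  obtain ⟨R, hR⟩ := hBb.exists_norm_le
  obtain ⟨N, V, hN, hNle, hV, hlim⟩ := exists_measurable_subseq_of_bounded hW
    fun ω => ⟨R, fun n => hR _ (hWB n ω)⟩
  have hq : Tendsto (fun n : ℕ => ((-(n : ℝ) : ℝ) : EReal)) atTop (𝓝 ⊥) :=
    (EReal.tendsto_coe_nhds_bot_iff).2 (tendsto_neg_atTop_atBot.comp tendsto_natCast_atTop_atTop)
  have hle := h.le_of_tendsto (A := {ω | condEssInf m P (Φ '' {W | Measurable[m] W ∧ ∀ ω, W ω ∈ B}) ω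
    = ⊥}) hV (fun k => Measurable.comp_index hW (hN k)) hlim
    (q := fun k ω => ((-(N k ω : ℝ) : ℝ) : EReal)) (q' := fun _ => ⊥)
    (fun ω => hq.comp (tendsto_atTop_mono (fun k => hNle k ω) tendsto_id)) (by
      intro k
      filter_upwards [h.comp_index hW (hN k), ae_all_iff.2 hlt] with ω h1 h2 (h3 : _ = _)
      rw [h1]
      exact (h2 _ (by rw [h3]; exact EReal.bot_lt_coe _)).le)
  filter_upwards [hle, hbot V hV] with ω h1 h2 h3
  exact absurd (h1 h3) h2.not_ge

/-- The value at `x` is recovered as the supremum, over a countable family of balls containing `x`,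
of the essential infimum of `Φ` on variables valued in the ball. Locality gives one inequality and
lower semicontinuity the other. -/
theorem IsLocalLSC.exists_isNormalIntegrand [IsFiniteMeasure P] (h : IsLocalLSC m P Φ) (hm : m ≤ mΩ)
    (hbot : ∀ V, Measurable[m] V → ∀ᵐ ω ∂P, ⊥ < Φ V ω) {H : Ω → E → ℝ}
    (hH : IsNormalIntegrand m H)
    (hle : ∀ V, Measurable[m] V → ∀ᵐ ω ∂P, Φ V ω ≤ ((H ω (V ω) : ℝ) : EReal)) :
    ∃ γ : Ω → E → ℝ, IsNormalIntegrand m γ ∧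
      ∀ V, Measurable[m] V → ∀ᵐ ω ∂P, Φ V ω = ((γ ω (V ω) : ℝ) : EReal) := by
  classical
  let c := TopologicalSpace.denseSeq E
  let B : ℕ × ℕ → Set E := fun i => Metric.ball (c i.1) (1 / ((i.2 : ℝ) + 1))
  have hcB : ∀ i, c i.1 ∈ B i := fun i => Metric.mem_ball_self Nat.one_div_pos_of_nat
  have hcover : ∀ x k, ∃ j, x ∈ B (j, k) := fun x k =>
    (TopologicalSpace.denseRange_denseSeq E).exists_dist_lt x Nat.one_div_pos_of_nat
  let μ : ℕ × ℕ → Ω → EReal := fun i =>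
    condEssInf m P (Φ '' {W | Measurable[m] W ∧ ∀ ω, W ω ∈ B i})
  have hμ : ∀ i, Measurable[m] (μ i) := fun i => measurable_condEssInf hm _
  let A : Set Ω := {ω | ∀ i, μ i ω ≠ ⊥}
  have hA : MeasurableSet[m] A := by
    have : A = ⋂ i, μ i ⁻¹' {⊥}ᶜ := by ext; simp [A]
    rw [this]
    exact MeasurableSet.iInter fun i => hμ i (measurableSet_singleton _).compl
  have hAae : ∀ᵐ ω ∂P, ω ∈ A := ae_all_iff.2 fun i =>
    h.condEssInf_ne_bot hm hbot ⟨_, hcB i⟩ Metric.isBounded_ball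
  -- Each term is lower semicontinuous because the ball is open, and jointly measurable because it
  -- is a product of simple data.
  let g : Ω → E → EReal := fun ω x => ⨆ i, if x ∈ B i then μ i ω else ⊥
  have hg_meas : Measurable[m.prod inferInstance] fun p : Ω × E => g p.1 p.2 :=
    Measurable.iSup fun i => Measurable.ite (measurable_snd Metric.isOpen_ball.measurableSet)
      ((hμ i).comp measurable_fst) measurable_const
  have hg_lsc : ∀ ω, LowerSemicontinuous (g ω) := by
    intro ω
    refine lowerSemicontinuous_iSup fun i x y hy => ?_
    by_cases hx : x ∈ B i
    · filter_upwards [Metric.isOpen_ball.mem_nhds hx] with z hz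
      change y < if z ∈ B i then μ i ω else ⊥
      rw [if_pos hz]
      simpa only [if_pos hx] using hy
    · simp [hx] at hy
  have hg_rep : ∀ V, Measurable[m] V → ∀ᵐ ω ∂P, Φ V ω = g ω (V ω) := by
    intro V hV
    have hmemB : ∀ i, MeasurableSet[m] {ω | V ω ∈ B i} := fun i =>
      hV Metric.isOpen_ball.measurableSet
    have hge : ∀ᵐ ω ∂P, g ω (V ω) ≤ Φ V ω := by
      have hi : ∀ i, ∀ᵐ ω ∂P, V ω ∈ B i → μ i ω ≤ Φ V ω := by
        intro i
        let V' : Ω → E := fun ω => if V ω ∈ B i then V ω else c i.1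
        have hV' : Measurable[m] V' := Measurable.ite (hmemB i) hV measurable_const
        have hV'B : ∀ ω, V' ω ∈ B i := by
          intro ω
          by_cases hω : V ω ∈ B i
          · simpa only [V', if_pos hω] using hω
          · simpa only [V', if_neg hω] using hcB i
        have hle' : ∀ᵐ ω ∂P, μ i ω ≤ Φ V' ω :=
          (isCondEssInf_condEssInf hm P _).le _ ⟨V', ⟨hV', hV'B⟩, rfl⟩
        filter_upwards [hle',
          h.congr_on V' V hV' hV _ (hmemB i) fun ω (hω : V ω ∈ B i) => if_pos hω] with ω h1 h2 h3
        exact h1.trans_eq (h2 h3)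
      filter_upwards [ae_all_iff.2 hi] with ω h1
      refine iSup_le fun i => ?_
      split_ifs with h2
      exacts [h1 i h2, bot_le]
    -- In every ball `B i` some `W i` satisfies `Φ (W i) < q` wherever `μ i < q`. Selecting at level
    -- `k` the first ball of radius `1 / (k + 1)` containing `V` yields variables converging to `V`.
    have hlt : ∀ q : ℚ, ∀ᵐ ω ∂P, g ω (V ω) < ((q : ℝ) : EReal) → Φ V ω ≤ ((q : ℝ) : EReal) := by
      intro q
      choose W hW hWB hWlt using fun i => h.exists_lt_of_condEssInf_lt hm ⟨_, hcB i⟩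
        (q := fun _ => ((q : ℝ) : EReal)) measurable_const
      choose J hJ hJmem using fun k : ℕ => exists_measurable_first fun j => hmemB (j, k)
      refine h.le_of_tendsto (W := fun k ω => W (J k ω, k) ω) hV
        (fun k => Measurable.comp_index (fun j => hW (j, k)) (hJ k)) (fun ω => ?_)
        (q := fun _ _ => ((q : ℝ) : EReal)) (fun _ => tendsto_const_nhds)
        (A := {ω | g ω (V ω) < ((q : ℝ) : EReal)}) fun k => ?_
      · rw [tendsto_iff_dist_tendsto_zero]
        have h0 := (tendsto_one_div_add_atTop_nhds_zero_nat (𝕜 := ℝ)).const_mul 2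
        rw [mul_zero] at h0
        refine squeeze_zero (fun _ => dist_nonneg) (fun k => ?_) h0
        have h1 : dist (W (J k ω, k) ω) (c (J k ω)) < 1 / ((k : ℝ) + 1) := hWB (J k ω, k) ω
        have h2 : dist (V ω) (c (J k ω)) < 1 / ((k : ℝ) + 1) := hJmem k ω (hcover (V ω) k)
        have h3 := dist_triangle_right (W (J k ω, k) ω) (V ω) (c (J k ω))
        linarith
      · filter_upwards [h.comp_index (fun j => hW (j, k)) (hJ k), ae_all_iff.2 hWlt]
          with ω h1 h2 (h3 : g ω (V ω) < _)
        rw [h1]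
        refine (h2 _ (lt_of_le_of_lt ?_ h3)).le
        refine le_iSup_of_le (J k ω, k) ?_
        rw [if_pos (hJmem k ω (hcover (V ω) k))]
    filter_upwards [hge, ae_all_iff.2 hlt] with ω h1 h2
    refine le_antisymm (le_of_forall_gt_imp_ge_of_dense fun y hy => ?_) h1
    obtain ⟨q, hq1, hq2⟩ := EReal.lt_iff_exists_rat_btwn.1 hy
    exact (h2 q hq1).trans hq2.le
  have hg_bot : ∀ ω ∈ A, ∀ x, g ω x ≠ ⊥ := by
    intro ω hω x hx
    obtain ⟨j, hj⟩ := hcover x 0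
    have := iSup_eq_bot.1 hx (j, 0)
    rw [if_pos hj] at this
    exact hω _ this
  -- Capping by `H` excludes `⊤` everywhere and changes nothing along any `V`, since `Φ V ≤ H(V)`
  -- a.s.
  let G : Ω → E → EReal := fun ω x => min (g ω x) ((H ω x : ℝ) : EReal)
  have hG : ∀ ω ∈ A, ∀ x, ((G ω x).toReal : EReal) = G ω x := fun ω hω x =>
    EReal.coe_toReal (ne_top_of_le_ne_top (EReal.coe_ne_top _) (min_le_right _ _))
      (by simp [G, min_eq_bot, hg_bot ω hω x])
  refine ⟨fun ω x => if ω ∈ A then (G ω x).toReal else 0, ⟨?_, fun ω => ?_⟩, fun V hV => ?_⟩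
  · exact Measurable.ite (measurable_fst hA)
      (hg_meas.min hH.measurable.coe_real_ereal).ereal_toReal measurable_const
  · by_cases hω : ω ∈ A
    · simp only [if_pos hω]
      intro x y hy
      have hy' : (y : EReal) < G ω x := by rw [← hG ω hω x]; exact_mod_cast hy
      have h1 := hg_lsc ω x y (hy'.trans_le (min_le_left _ _))
      have h2 := hH.lowerSemicontinuous ω x y
        (EReal.coe_lt_coe_iff.1 (hy'.trans_le (min_le_right _ _)))
      filter_upwards [h1, h2] with z h3 h4
      refine EReal.coe_lt_coe_iff.1 ?_
      rw [hG ω hω z]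
      exact lt_min h3 (EReal.coe_lt_coe_iff.2 h4)
    · simpa only [if_neg hω] using lowerSemicontinuous_const
  · filter_upwards [hAae, hg_rep V hV, hle V hV] with ω h1 h2 h3
    rw [if_pos h1, hG ω h1, h2]
    exact (min_eq_left (h2 ▸ h3)).symm

end Representation

/-! ### Extended-real inequalities and removal of the cash component -/

section Auxiliary

theorem EReal.coe_add_le_iff_le_neg_add {c : ℝ} {x y : EReal} :
    (c : EReal) + x ≤ y ↔ x ≤ ((-c : ℝ) : EReal) + y := by
  induction x using EReal.rec <;> induction y using EReal.rec <;>
    simp [← EReal.coe_add, -EReal.coe_neg]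

theorem EReal.le_of_forall_le_one_div_add {x y : EReal}
    (h : ∀ n : ℕ, x ≤ ((1 / ((n : ℝ) + 1) : ℝ) : EReal) + y) : x ≤ y := by
  induction y using EReal.rec with
  | bot => simpa using h 0
  | top => exact le_top
  | coe y =>
    have h1 : Tendsto (fun n : ℕ => ((1 / ((n : ℝ) + 1) + y : ℝ) : EReal)) atTop
        (𝓝 ((0 + y : ℝ) : EReal)) :=
      EReal.tendsto_coe.2 (tendsto_one_div_add_atTop_nhds_zero_nat.add_const y)
    rw [zero_add] at h1
    exact ge_of_tendsto' h1 fun n => by exact_mod_cast h n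

theorem LowerSemicontinuous.coe_le_liminf {E : Type*} [TopologicalSpace E] {f : E → ℝ}
    (hf : LowerSemicontinuous f) {x : ℕ → E} {y : E} (h : Tendsto x atTop (𝓝 y)) :
    (f y : EReal) ≤ liminf (fun n => (f (x n) : EReal)) atTop := by
  have hf' : LowerSemicontinuous fun z => (f z : EReal) :=
    continuous_coe_real_ereal.comp_lowerSemicontinuous hf EReal.coe_strictMono.monotone
  refine le_of_forall_lt fun a ha => ?_
  obtain ⟨b, hab, hb⟩ := exists_between ha
  exact hab.trans_le (le_liminf_of_le (by isBoundedDefault)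
    ((h.eventually (hf' y b hb)).mono fun _ h => h.le))

variable {d : ℕ} [NeZero d]

theorem dropCash_zero : dropCash (0 : EuclideanSpace ℝ (Fin d)) = 0 := by simp [dropCash]

theorem dropCash_sub (x y : EuclideanSpace ℝ (Fin d)) :
    dropCash (x - y) = dropCash x - dropCash y := by
  ext i
  by_cases h : i = 0 <;> simp [dropCash, h]

theorem dropCash_smul (r : ℝ) (x : EuclideanSpace ℝ (Fin d)) :
    dropCash (r • x) = r • dropCash x := by
  ext i
  by_cases h : i = 0 <;> simp [dropCash, h]

theorem dropCash_dropCash (x : EuclideanSpace ℝ (Fin d)) :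
    dropCash (dropCash x) = dropCash x := by
  ext i
  by_cases h : i = 0 <;> simp [dropCash, h]

theorem dropCash_apply_zero (x : EuclideanSpace ℝ (Fin d)) : dropCash x 0 = 0 := by
  simp [dropCash]

theorem dropCash_eq_self {x : EuclideanSpace ℝ (Fin d)} (h : x 0 = 0) : dropCash x = x := by
  simp [dropCash, h]

theorem dropCash_nonneg {x : EuclideanSpace ℝ (Fin d)} (h : ∀ i, 0 ≤ x i) (i : Fin d) :
    0 ≤ dropCash x i := by
  by_cases hi : i = 0 <;> simp [dropCash, hi, h]

theorem continuous_dropCash :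
    Continuous (dropCash : EuclideanSpace ℝ (Fin d) → EuclideanSpace ℝ (Fin d)) := by
  unfold dropCash
  have : (fun x : EuclideanSpace ℝ (Fin d) => EuclideanSpace.single (0 : Fin d) (x 0)) =
      fun x => x 0 • EuclideanSpace.single (0 : Fin d) (1 : ℝ) := by
    ext x i
    by_cases hi : i = 0 <;> simp [hi]
  rw [show (fun x : EuclideanSpace ℝ (Fin d) => x - EuclideanSpace.single (0 : Fin d) (x 0)) =
    fun x => x - x 0 • EuclideanSpace.single (0 : Fin d) (1 : ℝ) from
      funext fun x => by rw [← congrFun this x]]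
  fun_prop

end Auxiliary

/-! ### Dynamic programming -/

namespace CostMarket

variable {Ω : Type*} [mΩ : MeasurableSpace Ω] {P : Measure Ω} {m d : ℕ} [NeZero d]
  (M : CostMarket Ω P m d) {ξ : Ω → EuclideanSpace ℝ (Fin d)} {t : ℕ}

theorem measurable_C {u : ℕ} (hu : u ≤ M.T) {V : Ω → EuclideanSpace ℝ (Fin d)}
    (hV : Measurable[M.ℱ u] V) : Measurable[M.ℱ u] fun ω => M.C u ω (M.S u ω, V ω) :=
  (M.C_normal u hu).measurable.comp (measurable_id.prodMk ((M.S_measurable u hu).prodMk hV))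

theorem totalCost_congr {U U' : ℕ → Ω → EuclideanSpace ℝ (Fin d)} {ω : Ω}
    (h : ∀ s, t ≤ s → dropCash (U s ω) = dropCash (U' s ω)) :
    M.totalCost ξ t U ω = M.totalCost ξ t U' ω := by
  unfold totalCost
  congr 1
  refine Finset.sum_congr rfl fun s hs => ?_
  have hs' := (Finset.mem_Icc.1 hs).1
  rw [dropCash_sub, dropCash_sub, h s hs', h (s + 1) (by omega)]

theorem totalCost_eq_add (ht : t < M.T) (U : ℕ → Ω → EuclideanSpace ℝ (Fin d)) (ω : Ω) :
    M.totalCost ξ t U ω =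
      M.C t ω (M.S t ω, dropCash (U (t + 1) ω - U t ω)) + M.totalCost ξ (t + 1) U ω := by
  unfold totalCost
  rw [← Finset.add_sum_Ioc_eq_sum_Icc ht.le, ← Finset.Icc_add_one_left_eq_Ioc]
  ring

theorem mem_strategies_succ {W : Ω → EuclideanSpace ℝ (Fin d)}
    {U : ℕ → Ω → EuclideanSpace ℝ (Fin d)} (hU : U ∈ M.strategies ξ t W) :
    U ∈ M.strategies ξ (t + 1) (U (t + 1)) :=
  ⟨rfl, fun s hs => hU.2.1 s (by omega), hU.2.2⟩

theorem update_mem_strategies (ht : t ≤ M.T) {W : Ω → EuclideanSpace ℝ (Fin d)}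
    {U : ℕ → Ω → EuclideanSpace ℝ (Fin d)} (hU : U ∈ M.strategies ξ t W)
    (W' : Ω → EuclideanSpace ℝ (Fin d)) : Function.update U t W' ∈ M.strategies ξ t W' := by
  refine ⟨Function.update_self _ _ _, fun s hs hsT => ?_, ?_⟩
  · rw [Function.update_of_ne (by omega)]
    exact hU.2.1 s hs hsT
  · rw [Function.update_of_ne (by omega)]
    exact hU.2.2

theorem minCost_congr_dropCash (ht : t ≤ M.T) {W W' : Ω → EuclideanSpace ℝ (Fin d)}
    (h : ∀ ω, dropCash (W ω) = dropCash (W' ω)) : M.minCost ξ t W = M.minCost ξ t W' := by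
  have key : ∀ W W' : Ω → EuclideanSpace ℝ (Fin d), (∀ ω, dropCash (W ω) = dropCash (W' ω)) →
      ((fun U => condEssSup (M.ℱ t) P {fun ω => ((M.totalCost ξ t U ω : ℝ) : EReal)}) ''
        M.strategies ξ t W) ⊆
      ((fun U => condEssSup (M.ℱ t) P {fun ω => ((M.totalCost ξ t U ω : ℝ) : EReal)}) ''
        M.strategies ξ t W') := by
    rintro W W' h _ ⟨U, hU, rfl⟩
    refine ⟨_, M.update_mem_strategies ht hU W', ?_⟩
    have : ∀ ω, M.totalCost ξ t (Function.update U t W') ω = M.totalCost ξ t U ω := by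
      refine fun ω => M.totalCost_congr fun s hs => ?_
      rcases eq_or_ne s t with rfl | hst
      · rw [Function.update_self, ← h, hU.1]
      · rw [Function.update_of_ne hst]
    simp only [this]
  unfold minCost
  rw [(key W W' h).antisymm (key W' W fun ω => (h ω).symm)]

theorem D_dropCash (ht : t < M.T) (W Z : Ω → EuclideanSpace ℝ (Fin d)) :
    M.D ξ t W (fun ω => dropCash (Z ω)) = M.D ξ t W Z := by
  funext ω
  unfold D theta
  rw [M.minCost_congr_dropCash (W' := Z) ht fun ω => dropCash_dropCash (Z ω),
    dropCash_sub, dropCash_sub, dropCash_dropCash]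

/-- Switching by an index known at date `t` preserves adaptedness at all later dates; this is the
pasting required by the exhaustion lemma. -/
theorem strategies_comp_index {W : Ω → EuclideanSpace ℝ (Fin d)}
    {U : ℕ → ℕ → Ω → EuclideanSpace ℝ (Fin d)} (hU : ∀ n, U n ∈ M.strategies ξ t W)
    {N : Ω → ℕ} (hN : Measurable[M.ℱ t] N) :
    (fun s ω => U (N ω) s ω) ∈ M.strategies ξ t W := by
  refine ⟨funext fun ω => congrFun (hU (N ω)).1 ω, fun s hs hsT => ?_,
    funext fun ω => congrFun (hU (N ω)).2.2 ω⟩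
  exact Measurable.comp_index (X := fun n => U n (s + 1)) (fun n => (hU n).2.1 s hs hsT)
    (hN.mono (M.ℱ.mono hs) le_rfl)

theorem exists_mem_strategies (ht : t ≤ M.T)
    (W : Ω → EuclideanSpace ℝ (Fin d)) : (M.strategies ξ t W).Nonempty :=
  ⟨fun s => if s = t then W else if s = M.T + 1 then ξ else 0, by simp,
    fun s hs hsT => by
      simp only [if_neg (show s + 1 ≠ t by omega), if_neg (show s + 1 ≠ M.T + 1 by omega)]
      exact @measurable_const _ _ _ (M.ℱ s) 0,
    by simp [show M.T + 1 ≠ t by omega]⟩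

variable [IsFiniteMeasure P]

theorem measurable_minCost (W : Ω → EuclideanSpace ℝ (Fin d)) :
    Measurable[M.ℱ t] (M.minCost ξ t W) :=
  measurable_condEssInf (M.ℱ.le t) _

theorem measurable_theta (Z : Ω → EuclideanSpace ℝ (Fin d)) : Measurable[M.ℱ t] (M.theta ξ t Z) :=
  measurable_condEssSup (M.ℱ.le t) _

theorem measurable_D (ht : t ≤ M.T) {W Z : Ω → EuclideanSpace ℝ (Fin d)}
    (hW : Measurable[M.ℱ t] W) (hZ : Measurable[M.ℱ t] Z) : Measurable[M.ℱ t] (M.D ξ t W Z) :=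
  (M.measurable_C ht (continuous_dropCash.measurable.comp (hZ.sub hW))).coe_real_ereal.add
    (M.measurable_theta Z)

theorem minCost_le {W : Ω → EuclideanSpace ℝ (Fin d)} {U : ℕ → Ω → EuclideanSpace ℝ (Fin d)}
    (hU : U ∈ M.strategies ξ t W) : ∀ᵐ ω ∂P, M.minCost ξ t W ω ≤
      condEssSup (M.ℱ t) P {fun ω => ((M.totalCost ξ t U ω : ℝ) : EReal)} ω :=
  (isCondEssInf_condEssInf (M.ℱ.le t) P _).le _ ⟨U, hU, rfl⟩

theorem minCost_le_theta (Z : Ω → EuclideanSpace ℝ (Fin d)) :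
    ∀ᵐ ω ∂P, M.minCost ξ (t + 1) Z ω ≤ M.theta ξ t Z ω :=
  le_condEssSup_singleton (M.ℱ.le t) _

theorem theta_le {Z : Ω → EuclideanSpace ℝ (Fin d)} {Y : Ω → EReal} (hY : Measurable[M.ℱ t] Y)
    (h : ∀ᵐ ω ∂P, M.minCost ξ (t + 1) Z ω ≤ Y ω) : ∀ᵐ ω ∂P, M.theta ξ t Z ω ≤ Y ω :=
  (isCondEssSup_condEssSup (M.ℱ.le t) P _).least Y hY (by rintro _ rfl; exact h)

/-- The date-`t` trade is `ℱ_t`-measurable, so it can be subtracted from the essential supremum. The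
remainder dominates the later cost, hence `γ_{t+1}`, and, being `ℱ_t`-measurable, also `θ_t`. -/
theorem D_le_condEssSup_totalCost (ht : t < M.T) {W : Ω → EuclideanSpace ℝ (Fin d)}
    (hW : Measurable[M.ℱ t] W) {U : ℕ → Ω → EuclideanSpace ℝ (Fin d)}
    (hU : U ∈ M.strategies ξ t W) : ∀ᵐ ω ∂P, M.D ξ t W (U (t + 1)) ω ≤
      condEssSup (M.ℱ t) P {fun ω => ((M.totalCost ξ t U ω : ℝ) : EReal)} ω := by
  set Y := condEssSup (M.ℱ t) P {fun ω => ((M.totalCost ξ t U ω : ℝ) : EReal)} with hYdef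
  have hc : Measurable[M.ℱ t] fun ω => M.C t ω (M.S t ω, dropCash (U (t + 1) ω - W ω)) :=
    M.measurable_C ht.le (continuous_dropCash.measurable.comp ((hU.2.1 t le_rfl ht).sub hW))
  have hY' : Measurable[M.ℱ t] fun ω =>
      ((-M.C t ω (M.S t ω, dropCash (U (t + 1) ω - W ω)) : ℝ) : EReal) + Y ω :=
    hc.neg.coe_real_ereal.add (measurable_condEssSup (M.ℱ.le t) _)
  have h1 := (isCondEssSup_condEssSup (M.ℱ.le (t + 1)) P
    {fun ω => ((M.totalCost ξ (t + 1) U ω : ℝ) : EReal)}).least _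
    (hY'.mono (M.ℱ.mono (Nat.le_succ t)) le_rfl) (by
      rintro _ rfl
      filter_upwards [le_condEssSup_singleton (P := P) (M.ℱ.le t)
        (fun ω => ((M.totalCost ξ t U ω : ℝ) : EReal))] with ω hω
      rw [M.totalCost_eq_add ht, hU.1] at hω
      exact EReal.coe_add_le_iff_le_neg_add.1 (by exact_mod_cast hω))
  have h2 : ∀ᵐ ω ∂P, M.theta ξ t (U (t + 1)) ω ≤ _ := M.theta_le hY' (by
    filter_upwards [h1, M.minCost_le (M.mem_strategies_succ hU)] with ω h1 h2 using h2.trans h1)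
  filter_upwards [h2] with ω h using EReal.coe_add_le_iff_le_neg_add.2 h

theorem exists_condEssSup_totalCost_lt {W : Ω → EuclideanSpace ℝ (Fin d)}
    (hne : (M.strategies ξ t W).Nonempty)
    {q : Ω → EReal} (hq : Measurable[M.ℱ t] q) :
    ∃ U ∈ M.strategies ξ t W, ∀ᵐ ω ∂P, M.minCost ξ t W ω < q ω →
      condEssSup (M.ℱ t) P {fun ω => ((M.totalCost ξ t U ω : ℝ) : EReal)} ω < q ω := by
  have : Nonempty (M.strategies ξ t W) := hne.to_subtype
  have hY := isCondEssInf_condEssInf (M.ℱ.le t) P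
    ((fun U => condEssSup (M.ℱ t) P {fun ω => ((M.totalCost ξ t U ω : ℝ) : EReal)}) ''
      M.strategies ξ t W)
  nth_rw 1 [image_eq_range] at hY
  obtain ⟨⟨U, hU⟩, h⟩ := exists_lt_of_isCondEssInf (M.ℱ.le t)
    (F := fun U : M.strategies ξ t W =>
      condEssSup (M.ℱ t) P {fun ω => ((M.totalCost ξ t U ω : ℝ) : EReal)})
    (fun U => measurable_condEssSup (M.ℱ.le t) _)
    (fun u N hN => ⟨⟨_, M.strategies_comp_index (fun n => (u n).2) hN⟩,
      ae_eq_comp_index (F := fun n => condEssSup (M.ℱ t) P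
        {fun ω => ((M.totalCost ξ t (u n) ω : ℝ) : EReal)}) N fun n =>
        condEssSup_singleton_congr_on (M.ℱ.le t) (A := {ω | N ω = n})
          (hN (measurableSet_singleton n)) (Eventually.of_forall fun ω (hω : N ω = n) => by
            simp only [totalCost, hω])⟩) hY hq
  exact ⟨U, hU, h⟩

theorem minCost_le_D (ht : t < M.T) {W Z : Ω → EuclideanSpace ℝ (Fin d)}
    (hW : Measurable[M.ℱ t] W) (hZ : Measurable[M.ℱ t] Z)
    (hne : (M.strategies ξ (t + 1) Z).Nonempty)
    (hfin : ∀ᵐ ω ∂P, ∃ r : ℝ, M.minCost ξ (t + 1) Z ω = r) :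
    ∀ᵐ ω ∂P, M.minCost ξ t W ω ≤ M.D ξ t W Z ω := by
  have hD := M.measurable_D (ξ := ξ) ht.le hW hZ
  have h : ∀ n : ℕ, ∀ᵐ ω ∂P,
      M.minCost ξ t W ω ≤ ((1 / ((n : ℝ) + 1) : ℝ) : EReal) + M.D ξ t W Z ω := by
    intro n
    have hε : (0 : ℝ) < 1 / ((n : ℝ) + 1) := Nat.one_div_pos_of_nat
    -- Finiteness of `γ_{t+1}(Z)` makes this threshold strictly larger than it, so `U` is
    -- `ε`-optimal a.s.
    obtain ⟨U, hU, hlt⟩ := M.exists_condEssSup_totalCost_lt hne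
      (q := fun ω => ((1 / ((n : ℝ) + 1) : ℝ) : EReal) + M.minCost ξ (t + 1) Z ω)
      (measurable_const.add (M.measurable_minCost Z))
    -- The only new adaptedness condition is at `s = t`, where the position is the `ℱ_t`-measurable
    -- `Z`.
    have hU' : Function.update U t W ∈ M.strategies ξ t W := by
      refine ⟨Function.update_self _ _ _, fun s hs hsT => ?_, ?_⟩
      · rw [Function.update_of_ne (by omega)]
        rcases hs.eq_or_lt with rfl | hs
        · rwa [hU.1]
        · exact hU.2.1 s hs hsT
      · rw [Function.update_of_ne (by omega)]
        exact hU.2.2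
    have hle := (isCondEssSup_condEssSup (M.ℱ.le t) P
      {fun ω => ((M.totalCost ξ t (Function.update U t W) ω : ℝ) : EReal)}).least
      (fun ω => ((1 / ((n : ℝ) + 1) : ℝ) : EReal) + M.D ξ t W Z ω) (measurable_const.add hD) (by
        rintro _ rfl
        filter_upwards [hlt, hfin, le_condEssSup_singleton (P := P) (M.ℱ.le (t + 1))
          (fun ω => ((M.totalCost ξ (t + 1) U ω : ℝ) : EReal)), M.minCost_le_theta (ξ := ξ) Z]
          with ω h1 ⟨r, hr⟩ h3 h4
        have h5 : M.totalCost ξ (t + 1) (Function.update U t W) ω = M.totalCost ξ (t + 1) U ω :=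
          M.totalCost_congr fun s hs => by rw [Function.update_of_ne (by omega)]
        rw [M.totalCost_eq_add ht, h5, Function.update_self, Function.update_of_ne (by omega), hU.1,
          EReal.coe_add, D, add_left_comm]
        refine add_le_add le_rfl (h3.trans ((h1 ?_).le.trans (add_le_add le_rfl h4)))
        rw [hr]
        exact_mod_cast lt_add_of_pos_left r hε)
    filter_upwards [hle, M.minCost_le hU'] with ω h1 h2 using h2.trans h1
  filter_upwards [ae_all_iff.2 h] with ω hω using EReal.le_of_forall_le_one_div_add hω

/-- The dynamic programming principle. -/
theorem isCondEssInf_minCost (ht : t < M.T)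
    {W : Ω → EuclideanSpace ℝ (Fin d)} (hW : Measurable[M.ℱ t] W)
    (hfin : ∀ Z : Ω → EuclideanSpace ℝ (Fin d), Measurable[M.ℱ t] Z →
      ∀ᵐ ω ∂P, ∃ r : ℝ, M.minCost ξ (t + 1) Z ω = r) :
    IsCondEssInf (M.ℱ t) P (M.D ξ t W '' {Z | Measurable[M.ℱ t] Z}) (M.minCost ξ t W) where
  measurable := M.measurable_minCost W
  le := by
    rintro _ ⟨Z, hZ, rfl⟩
    exact M.minCost_le_D ht hW hZ (M.exists_mem_strategies ht Z) (hfin Z hZ)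
  greatest Y hY h := (isCondEssInf_condEssInf (M.ℱ.le t) P _).greatest Y hY (by
    rintro _ ⟨U, hU, rfl⟩
    filter_upwards [h _ ⟨U (t + 1), hU.2.1 t le_rfl ht, rfl⟩,
      M.D_le_condEssSup_totalCost ht hW hU] with ω h1 h2 using h1.trans h2)

end CostMarket

/-! ### Scaling and coercivity -/

namespace CostMarket

variable {Ω : Type*} [mΩ : MeasurableSpace Ω] {P : Measure Ω} {m d : ℕ} [NeZero d]
  (M : CostMarket Ω P m d) {ξ : Ω → EuclideanSpace ℝ (Fin d)} {t : ℕ}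

theorem ae_S_nonneg : ∀ᵐ ω ∂P, ∀ u ≤ M.T, ∀ i, 0 ≤ M.S u ω i :=
  ae_all_iff.2 fun u => by
    by_cases hu : u ≤ M.T
    · filter_upwards [M.S_nonneg u hu] with ω h _ using h
    · exact Eventually.of_forall fun ω h => absurd h hu

/-- Cash invariance forces `δ r = r` for `r ≥ 1`. -/
theorem SuperHomogeneous.mul_le {M : CostMarket Ω P m d} {δ : ℝ≥0∞ ≃o ℝ≥0∞} {u : ℕ}
    (h : M.SuperHomogeneous δ u) (hu : u ≤ M.T) (ω : Ω) {s : EuclideanSpace ℝ (Fin m)}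
    (hs : ∀ i, 0 ≤ s i) (x : EuclideanSpace ℝ (Fin d)) {r : ℝ} (hr : 1 ≤ r) :
    r * M.C u ω (s, x) ≤ M.C u ω (s, r • x) := by
  have hC : ∀ a : ℝ, M.C u ω (s, EuclideanSpace.single 0 a) = a := fun a => by
    have := M.C_cash u hu ω s hs 0 a
    rwa [zero_add, M.C_zero u hu ω s hs, zero_add] at this
  have h1 : ∀ a : ℝ, (δ (ENNReal.ofReal r)).toReal * a ≤ r * a := by
    intro a
    have h2 := h ω s hs (EuclideanSpace.single 0 a) r hr
    have h3 : r • EuclideanSpace.single (0 : Fin d) a = EuclideanSpace.single 0 (r * a) := by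
      ext i
      by_cases hi : i = 0 <;> simp [hi]
    rwa [h3, hC, hC] at h2
  -- Pure cash positions of both signs, `a = 1` and `a = -1`, give the two inequalities.
  have h4 : (δ (ENNReal.ofReal r)).toReal = r :=
    le_antisymm (by simpa using h1 1) (by simpa using h1 (-1))
  simpa only [h4] using h ω s hs x r hr

/-- The exceptional null set does not depend on the strategies or on `r`, which allows random
scaling factors later. -/
theorem mul_totalCost_le {δ : ℝ≥0∞ ≃o ℝ≥0∞}
    (hδ : ∀ u, t ≤ u → u ≤ M.T → M.SuperHomogeneous δ u) :
    ∀ᵐ ω ∂P, ∀ (U U' : ℕ → Ω → EuclideanSpace ℝ (Fin d)) (r : ℝ), 1 ≤ r →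
      (∀ s, t ≤ s → s ≤ M.T + 1 → dropCash (U s ω) = r • dropCash (U' s ω)) →
      r * M.totalCost 0 t U' ω ≤ M.totalCost 0 t U ω := by
  filter_upwards [M.ae_S_nonneg] with ω hS U U' r hr h
  unfold totalCost
  simp only [Pi.zero_apply, PiLp.zero_apply, zero_add, Finset.mul_sum]
  refine Finset.sum_le_sum fun s hs => ?_
  obtain ⟨hts, hsT⟩ := Finset.mem_Icc.1 hs
  refine ((hδ s hts hsT).mul_le hsT ω (hS s hsT) _ hr).trans_eq ?_
  rw [dropCash_sub, dropCash_sub, smul_sub, ← h s hts (by omega), ← h (s + 1) (by omega) (by omega)]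

/-- Super-additivity splits `x - y` as `x + (-y)`; sub-additivity splits `x` as `(x - y) + y`.
Either way the error is controlled by the continuous bound on the cost, at `-y` or at `y`. -/
theorem exists_le_C_sub (ht : t ≤ M.T) (hadd : M.SuperAdditive t ∨ M.SubAdditive t) :
    ∃ k : EuclideanSpace ℝ (Fin m) × EuclideanSpace ℝ (Fin d) → ℝ, Continuous k ∧
      ∀ ω s, (∀ i, 0 ≤ s i) → ∀ x y, M.C t ω (s, x) - k (s, y) ≤ M.C t ω (s, x - y) := by
  obtain ⟨h, hh, hle⟩ := M.C_bound t ht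
  rcases hadd with hadd | hadd
  · refine ⟨fun p => h (p.1, -p.2), by fun_prop, fun ω s hs x y => ?_⟩
    have h1 := hadd ω s hs x (-y)
    have h2 := neg_abs_le (M.C t ω (s, -y))
    have h3 := hle ω s hs (-y)
    rw [← sub_eq_add_neg] at h1
    change _ - h (s, -y) ≤ _
    linarith
  · refine ⟨h, hh, fun ω s hs x y => ?_⟩
    have h1 := hadd ω s hs (x - y) y
    have h2 := le_abs_self (M.C t ω (s, y))
    have h3 := hle ω s hs y
    rw [sub_add_cancel] at h1
    linarith

variable [IsFiniteMeasure P]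

/-- Keeping the strategy but ending at `0` drops `ξ¹ ≥ 0` and lowers the last purchase
componentwise, where `C_T` is monotone. -/
theorem minCost_zero_le (ht : t ≤ M.T) (hξ : ∀ ω i, 0 ≤ ξ ω i)
    (Z : Ω → EuclideanSpace ℝ (Fin d)) :
    ∀ᵐ ω ∂P, M.minCost 0 t Z ω ≤ M.minCost ξ t Z ω := by
  refine (isCondEssInf_condEssInf (M.ℱ.le t) P _).greatest _ (M.measurable_minCost Z) ?_
  rintro _ ⟨U, hU, rfl⟩
  have hU' : Function.update U (M.T + 1) 0 ∈ M.strategies 0 t Z := by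
    refine ⟨?_, fun s hs hsT => ?_, Function.update_self _ _ _⟩
    · rw [Function.update_of_ne (by omega), hU.1]
    · rw [Function.update_of_ne (by omega)]
      exact hU.2.1 s hs hsT
  have hle : ∀ᵐ ω ∂P, ((M.totalCost 0 t (Function.update U (M.T + 1) 0) ω : ℝ) : EReal) ≤
      ((M.totalCost ξ t U ω : ℝ) : EReal) := by
    filter_upwards [M.ae_S_nonneg] with ω hS
    rw [EReal.coe_le_coe_iff]
    refine add_le_add (hξ ω 0) (Finset.sum_le_sum fun s hs => ?_)
    have hsT := (Finset.mem_Icc.1 hs).2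
    rw [Function.update_of_ne (a := s) (by omega)]
    rcases hsT.eq_or_lt with rfl | hsT
    · rw [Function.update_self, hU.2.2]
      refine M.C_mono ω _ (hS _ le_rfl) _ _ fun i => ?_
      rw [dropCash_sub, dropCash_sub]
      have := dropCash_nonneg (hξ ω) i
      simpa [dropCash_zero] using this
    · rw [Function.update_of_ne (by omega)]
  filter_upwards [M.minCost_le hU', condEssSup_singleton_mono (M.ℱ.le t) hle] with ω h1 h2
    using h1.trans h2

theorem theta_zero_le (ht : t < M.T) (hξ : ∀ ω i, 0 ≤ ξ ω i)
    (Z : Ω → EuclideanSpace ℝ (Fin d)) : ∀ᵐ ω ∂P, M.theta 0 t Z ω ≤ M.theta ξ t Z ω :=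
  condEssSup_singleton_mono (M.ℱ.le t) (M.minCost_zero_le ht hξ Z)

/-- Positive super-homogeneity of the minimal cost of the zero claim, with random factors. -/
theorem mul_minCost_zero_le {δ : ℝ≥0∞ ≃o ℝ≥0∞}
    (hδ : ∀ u, t ≤ u → u ≤ M.T → M.SuperHomogeneous δ u) (ht : t ≤ M.T)
    {Y Z : Ω → EuclideanSpace ℝ (Fin d)} {r : Ω → ℝ} (hr : Measurable[M.ℱ t] r)
    (hY : ∀ ω, 1 ≤ r ω → dropCash (Z ω) = r ω • dropCash (Y ω)) :
    ∀ᵐ ω ∂P, 1 ≤ r ω → (r ω : EReal) * M.minCost 0 t Y ω ≤ M.minCost 0 t Z ω := by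
  classical
  have hrm : MeasurableSet[M.ℱ t] {ω | 1 ≤ r ω} := measurableSet_le measurable_const hr
  refine (isCondEssInf_condEssInf (M.ℱ.le t) P _).le_on (hr.coe_real_ereal.mul (M.measurable_minCost Y))
    (A := {ω | 1 ≤ r ω}) hrm ?_
  rintro _ ⟨U, hU, rfl⟩
  -- Shrinking a strategy from `Z` by `1 / r` gives one from `Y` that still ends at `0`. The value
  -- off `{1 ≤ r}` is irrelevant.
  let U' : ℕ → Ω → EuclideanSpace ℝ (Fin d) := fun s ω =>
    if s = t then Y ω else if 1 ≤ r ω then (r ω)⁻¹ • U s ω else 0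
  have hU' : U' ∈ M.strategies 0 t Y := by
    refine ⟨by simp [U'], fun s hs hsT => ?_, ?_⟩
    · have h1 : M.ℱ t ≤ M.ℱ s := M.ℱ.mono hs
      simp only [U', if_neg (show s + 1 ≠ t by omega)]
      exact Measurable.ite (h1 _ hrm) ((hr.mono h1 le_rfl).inv.smul (hU.2.1 s hs hsT))
        measurable_const
    · funext ω
      have : U (M.T + 1) ω = 0 := congrFun hU.2.2 ω
      simp [U', show M.T + 1 ≠ t by omega, this]
  have hle := condEssSup_singleton_le_on (M.ℱ.le t) (P := P)
    (X := fun ω => ((M.totalCost 0 t U' ω : ℝ) : EReal))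
    (Z := fun ω => (((r ω)⁻¹ : ℝ) : EReal) *
      condEssSup (M.ℱ t) P {fun ω => ((M.totalCost 0 t U ω : ℝ) : EReal)} ω)
    (hr.inv.coe_real_ereal.mul (measurable_condEssSup (M.ℱ.le t) _)) (A := {ω | 1 ≤ r ω}) hrm (by
      filter_upwards [M.mul_totalCost_le hδ, le_condEssSup_singleton (P := P) (M.ℱ.le t)
        (fun ω => ((M.totalCost 0 t U ω : ℝ) : EReal))] with ω h1 h2 (h3 : 1 ≤ r ω)
      have h4 := h1 U U' (r ω) h3 fun s hts hsT => by
        rcases hts.eq_or_lt with rfl | hts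
        · simpa [U', hU.1] using hY ω h3
        · simp only [U', if_neg hts.ne', if_pos h3]
          rw [dropCash_smul, smul_inv_smul₀ (by linarith)]
      have h5 : M.totalCost 0 t U' ω ≤ (r ω)⁻¹ * M.totalCost 0 t U ω := by
        rw [le_inv_mul_iff₀ (by linarith)]
        exact h4
      refine (EReal.coe_le_coe_iff.2 h5).trans ?_
      rw [EReal.coe_mul]
      exact mul_le_mul_of_nonneg_left h2 (EReal.coe_nonneg.2 (by positivity)))
  filter_upwards [hle, M.minCost_le hU'] with ω h1 h2 (h3 : 1 ≤ r ω)
  have h4 := mul_le_mul_of_nonneg_left (h2.trans (h1 h3))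
    (EReal.coe_nonneg.2 (zero_le_one.trans h3))
  rwa [← mul_assoc, ← EReal.coe_mul, mul_inv_cancel₀ (by linarith), EReal.coe_one, one_mul] at h4

theorem mul_theta_zero_le {δ : ℝ≥0∞ ≃o ℝ≥0∞}
    (hδ : ∀ u, t ≤ u → u ≤ M.T → M.SuperHomogeneous δ u) (ht : t < M.T)
    {Y Z : Ω → EuclideanSpace ℝ (Fin d)} {r : Ω → ℝ} (hr : Measurable[M.ℱ t] r)
    (hY : ∀ ω, 1 ≤ r ω → dropCash (Z ω) = r ω • dropCash (Y ω)) :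
    ∀ᵐ ω ∂P, 1 ≤ r ω → (r ω : EReal) * M.theta 0 t Y ω ≤ M.theta 0 t Z ω := by
  have hrm : MeasurableSet[M.ℱ t] {ω | 1 ≤ r ω} := measurableSet_le measurable_const hr
  have h := condEssSup_singleton_le_on (M.ℱ.le t) (P := P) (X := M.minCost 0 (t + 1) Y)
    (Z := fun ω => (((r ω)⁻¹ : ℝ) : EReal) * M.theta 0 t Z ω)
    (hr.inv.coe_real_ereal.mul (M.measurable_theta Z)) (A := {ω | 1 ≤ r ω}) hrm (by
      filter_upwards [M.mul_minCost_zero_le (t := t + 1) (fun u hu => hδ u (by omega)) ht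
        (hr.mono (M.ℱ.mono t.le_succ) le_rfl) hY, M.minCost_le_theta (ξ := 0) Z]
        with ω h1 h2 (h3 : 1 ≤ r ω)
      have h4 := mul_le_mul_of_nonneg_left ((h1 h3).trans h2)
        (EReal.coe_nonneg.2 (inv_nonneg.2 (zero_le_one.trans h3)))
      rwa [← mul_assoc, ← EReal.coe_mul, inv_mul_cancel₀ (by linarith), EReal.coe_one,
        one_mul] at h4)
  filter_upwards [h] with ω h1 (h3 : 1 ≤ r ω)
  have h4 := mul_le_mul_of_nonneg_left (h1 h3) (EReal.coe_nonneg.2 (zero_le_one.trans h3))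
  rwa [← mul_assoc, ← EReal.coe_mul, mul_inv_cancel₀ (by linarith), EReal.coe_one, one_mul] at h4

/-- Coercivity of `D_t^ξ(S_t, W, ·)`. -/
theorem exists_coercive {δ : ℝ≥0∞ ≃o ℝ≥0∞}
    (hδ : ∀ u, t ≤ u → u ≤ M.T → M.SuperHomogeneous δ u) (ht : t < M.T)
    (hadd : M.SuperAdditive t ∨ M.SubAdditive t) (hξ : ∀ ω i, 0 ≤ ξ ω i)
    (hpos : ∀ᵐ ω ∂P, 0 < M.sphereInf t ω) :
    ∃ (k : EuclideanSpace ℝ (Fin m) × EuclideanSpace ℝ (Fin d) → ℝ) (c : Ω → ℝ), Continuous k ∧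
      (∀ᵐ ω ∂P, 0 < c ω) ∧ ∀ W Z : Ω → EuclideanSpace ℝ (Fin d), Measurable[M.ℱ t] Z →
        ∀ᵐ ω ∂P, 1 ≤ ‖dropCash (Z ω)‖ →
          ((‖dropCash (Z ω)‖ * c ω - k (M.S t ω, dropCash (W ω)) : ℝ) : EReal) ≤
            M.D ξ t W Z ω := by
  classical
  obtain ⟨k, hk, hkle⟩ := M.exists_le_C_sub ht.le hadd
  -- Truncation at `1` keeps the rate finite, as `i_t` may be `⊤`.
  refine ⟨k, fun ω => (min (M.sphereInf t ω) 1).toReal, hk, ?_, fun W Z hZ => ?_⟩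
  · filter_upwards [hpos] with ω hω
    exact EReal.toReal_pos (lt_min hω zero_lt_one)
      (ne_top_of_le_ne_top (EReal.coe_ne_top 1) (min_le_right _ _))
  -- The sphere is empty when `d = 1`; a point `ω₀` with a large risky position supplies a default
  -- element of it.
  by_cases hex : ∃ ω, 1 ≤ ‖dropCash (Z ω)‖
  swap
  · push Not at hex
    exact Eventually.of_forall fun ω h => absurd h (hex ω).not_ge
  obtain ⟨ω₀, hω₀⟩ := hex
  let r : Ω → ℝ := fun ω => ‖dropCash (Z ω)‖
  let v : EuclideanSpace ℝ (Fin d) → EuclideanSpace ℝ (Fin d) := fun x =>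
    ‖dropCash x‖⁻¹ • dropCash x
  have hv0 : ∀ x, v x 0 = 0 := fun x => by simp [v, dropCash_apply_zero]
  have hv1 : ∀ x, 1 ≤ ‖dropCash x‖ → ‖v x‖ = 1 := fun x hx => by
    have : ‖dropCash x‖ ≠ 0 := by linarith
    simp [v, norm_smul, this]
  have hZd : Measurable[M.ℱ t] fun ω => dropCash (Z ω) := continuous_dropCash.measurable.comp hZ
  have hr : Measurable[M.ℱ t] r := continuous_norm.measurable.comp hZd
  let Y : Ω → EuclideanSpace ℝ (Fin d) := fun ω => if 1 ≤ r ω then v (Z ω) else v (Z ω₀)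
  have hYm : Measurable[M.ℱ t] Y := Measurable.ite (measurableSet_le measurable_const hr)
    (hr.inv.smul hZd) measurable_const
  have hYs : ∀ ω, Y ω 0 = 0 ∧ ‖Y ω‖ = 1 := by
    intro ω
    by_cases h : 1 ≤ r ω
    · simp only [Y, if_pos h]
      exact ⟨hv0 _, hv1 _ h⟩
    · simp only [Y, if_neg h]
      exact ⟨hv0 _, hv1 _ hω₀⟩
  have hYd : ∀ ω, dropCash (Y ω) = Y ω := fun ω => dropCash_eq_self (hYs ω).1
  have hYr : ∀ ω, 1 ≤ r ω → dropCash (Z ω) = r ω • Y ω := by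
    intro ω h
    simp only [Y, if_pos h, v]
    rw [smul_inv_smul₀]
    change r ω ≠ 0
    linarith
  have hinf : ∀ᵐ ω ∂P, M.sphereInf t ω ≤ M.D 0 t 0 Y ω :=
    (isCondEssInf_condEssInf (M.ℱ.le t) P _).le _
      ⟨Y, ⟨hYm, Eventually.of_forall hYs⟩, rfl⟩
  filter_upwards [hinf, hpos, M.ae_S_nonneg, M.theta_zero_le ht hξ Z,
    M.mul_theta_zero_le hδ ht hr (Y := Y) (Z := Z) fun ω h => by rw [hYd, hYr ω h]]
    with ω h1 h2 h3 h4 h5 h6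
  set c := (min (M.sphereInf t ω) 1).toReal
  have hc : (c : EReal) ≤ M.sphereInf t ω := by
    have h8 : (c : EReal) = min (M.sphereInf t ω) 1 :=
      EReal.coe_toReal (ne_top_of_le_ne_top (EReal.coe_ne_top 1) (min_le_right _ _))
        (lt_min h2 zero_lt_one).ne_bot
    exact h8.trans_le (min_le_left _ _)
  have h7 : ((c - M.C t ω (M.S t ω, Y ω) : ℝ) : EReal) ≤ M.theta 0 t Y ω := by
    have h8 := hc.trans h1
    simp only [D, Pi.zero_apply, sub_zero, hYd] at h8
    have h9 := EReal.coe_add_le_iff_le_neg_add (c := -M.C t ω (M.S t ω, Y ω)) (x := c)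
      (y := M.theta 0 t Y ω)
    rw [neg_neg] at h9
    refine le_trans (le_of_eq ?_) (h9.2 h8)
    rw [← EReal.coe_add]
    congr 1
    ring
  -- With `r = ‖Z⁽²⁾‖`: `r (c - C_t(Y)) ≤ r θ⁰(Y) ≤ θ⁰(Z) ≤ θ^ξ(Z)`, while `r C_t(Y) ≤ C_t(Z⁽²⁾) ≤
  -- C_t(Z⁽²⁾ - W⁽²⁾) + k`. Adding these cancels `r C_t(Y)`.
  have h8 := mul_le_mul_of_nonneg_left h7 (EReal.coe_nonneg.2 (zero_le_one.trans h6))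
  have h9 := (h8.trans (h5 h6)).trans h4
  have h10 := (hδ t le_rfl ht.le).mul_le ht.le ω (h3 t ht.le) (Y ω) h6
  have h11 := hkle ω _ (h3 t ht.le) (dropCash (Z ω)) (dropCash (W ω))
  rw [show ‖dropCash (Z ω)‖ • Y ω = dropCash (Z ω) from (hYr ω h6).symm] at h10
  rw [D, dropCash_sub]
  refine le_trans ?_ (add_le_add le_rfl h9)
  rw [← EReal.coe_mul, ← EReal.coe_add, EReal.coe_le_coe_iff]
  linarith

end CostMarket

/-- With integer radii and bounds, composing `b` with a measurable integer-valued radius is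
automatically measurable. -/
theorem Continuous.exists_nat_bound_on_closedBall {E : Type*} [NormedAddCommGroup E]
    [ProperSpace E] {f : E → ℝ} (hf : Continuous f) :
    ∃ b : ℕ → ℕ, ∀ (n : ℕ) (x : E), ‖x‖ ≤ n → f x ≤ b n := by
  have h : ∀ n : ℕ, ∃ b : ℕ, ∀ x, ‖x‖ ≤ n → f x ≤ b := by
    intro n
    obtain ⟨c, hc⟩ := (isCompact_closedBall (0 : E) n).bddAbove_image hf.continuousOn
    exact ⟨⌈c⌉₊, fun x hx => (hc ⟨x, by simpa using hx, rfl⟩).trans (Nat.le_ceil c)⟩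
  choose b hb using h
  exact ⟨b, hb⟩

/-! ### Bounds from the support assumption, and lower semicontinuity of the minimal cost -/

namespace CostMarket

variable {Ω : Type*} [mΩ : MeasurableSpace Ω] {P : Measure Ω} {m d : ℕ} [NeZero d]
  (M : CostMarket Ω P m d) {ξ : Ω → EuclideanSpace ℝ (Fin d)} {t : ℕ}

/-- Under the support assumption, the future prices are bounded conditionally on `ℱ_t`. -/
theorem exists_norm_S_le (ht : t ≤ M.T) (hsupp : ∀ u, t ≤ u → u < M.T → M.SupportAssumption u)
    {u : ℕ} (htu : t ≤ u) (huT : u ≤ M.T) :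
    ∃ ρ : Ω → ℕ, Measurable[M.ℱ t] ρ ∧ ∀ᵐ ω ∂P, ‖M.S u ω‖ ≤ ρ ω := by
  induction u, htu using Nat.le_induction with
  | base =>
    exact ⟨fun ω => ⌈‖M.S t ω‖⌉₊,
      Nat.measurable_ceil.comp (continuous_norm.measurable.comp (M.S_measurable t ht)),
      Eventually.of_forall fun ω => Nat.le_ceil _⟩
  | succ u htu ih =>
    obtain ⟨ρ, hρ, hle⟩ := ih (by omega)
    obtain ⟨φ, R, A, -, -, hR, hA, hAφ, hφR⟩ := hsupp u htu huT
    obtain ⟨b, hb⟩ := hR.exists_nat_bound_on_closedBall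
    refine ⟨fun ω => b (ρ ω), (measurable_of_countable b).comp hρ, ?_⟩
    filter_upwards [hle, hA.mem, hAφ, hφR] with ω h1 h2 h3 h4
    have h5 := h4 (h3 ▸ h2)
    rw [mem_closedBall_zero_iff] at h5
    exact h5.trans (hb _ _ h1)

variable [IsFiniteMeasure P]

/-- Holding nothing risky until `T` and then buying `ξ` costs `C_T(S_T, g(S_T))`, which is bounded
conditionally on `ℱ_t` because `S_T` is. -/
theorem exists_theta_zero_position_le (ht : t < M.T)
    (hsupp : ∀ u, t ≤ u → u < M.T → M.SupportAssumption u)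
    {g : EuclideanSpace ℝ (Fin m) → EuclideanSpace ℝ (Fin d)} (hg : Continuous g)
    (hξ : ξ = fun ω => g (M.S M.T ω)) :
    ∃ K : Ω → ℝ, Measurable[M.ℱ t] K ∧ ∀ᵐ ω ∂P, M.theta ξ t 0 ω ≤ ((K ω : ℝ) : EReal) := by
  obtain ⟨h, hh, hle⟩ := M.C_bound M.T le_rfl
  obtain ⟨ρ, hρ, hSρ⟩ := M.exists_norm_S_le ht.le hsupp ht.le le_rfl
  obtain ⟨b, hb⟩ := (show Continuous fun s => h (s, g s) by fun_prop).exists_nat_bound_on_closedBall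
  have hK : Measurable[M.ℱ t] fun ω => (b (ρ ω) : ℝ) :=
    (measurable_of_countable fun n : ℕ => (b n : ℝ)).comp hρ
  refine ⟨fun ω => b (ρ ω), hK, M.theta_le hK.coe_real_ereal ?_⟩
  let U : ℕ → Ω → EuclideanSpace ℝ (Fin d) := fun s => if s = M.T + 1 then ξ else 0
  have hU : U ∈ M.strategies ξ (t + 1) 0 := by
    refine ⟨by simp [U, ht.ne], fun s hs hsT => ?_, by simp [U]⟩
    simp only [U, if_neg (show s + 1 ≠ M.T + 1 by omega)]
    exact @measurable_const _ _ _ (M.ℱ s) 0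
  have hcost : ∀ᵐ ω ∂P, ((M.totalCost ξ (t + 1) U ω : ℝ) : EReal) ≤ ((b (ρ ω) : ℝ) : EReal) := by
    filter_upwards [M.ae_S_nonneg, hSρ] with ω hS h1
    have h2 : M.totalCost ξ (t + 1) U ω = M.C M.T ω (M.S M.T ω, ξ ω) := by
      unfold totalCost
      rw [Finset.sum_eq_single_of_mem M.T (Finset.mem_Icc.2 ⟨ht, le_rfl⟩)]
      · have h3 := M.C_cash M.T le_rfl ω _ (hS _ le_rfl) (dropCash (ξ ω)) (ξ ω 0)
        simp only [U, if_true, if_neg (show M.T ≠ M.T + 1 by omega), Pi.zero_apply, sub_zero]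
        rw [add_comm, ← h3, dropCash, sub_add_cancel]
      · intro s hs hsT
        have hs' := (Finset.mem_Icc.1 hs).2
        simp only [U, if_neg (show s ≠ M.T + 1 by omega), if_neg (show s + 1 ≠ M.T + 1 by omega),
          Pi.zero_apply, sub_zero, dropCash_zero]
        exact M.C_zero s hs' ω _ (hS s hs')
    have h3 := hle ω _ (hS M.T le_rfl) (ξ ω)
    have h4 := hb _ _ h1
    rw [EReal.coe_le_coe_iff, h2]
    refine (le_abs_self _).trans (h3.trans ?_)
    rw [hξ]
    exact h4
  have h5 := (isCondEssSup_condEssSup (M.ℱ.le (t + 1)) P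
    {fun ω => ((M.totalCost ξ (t + 1) U ω : ℝ) : EReal)}).least _
    (hK.coe_real_ereal.mono (M.ℱ.mono t.le_succ) le_rfl) (by rintro _ rfl; exact hcost)
  filter_upwards [h5, M.minCost_le hU] with ω h6 h7 using h7.trans h6

/-- If the next minimal cost is represented by a normal integrand, then `θ_t^ξ` is a local lower
semicontinuous functional. -/
theorem isLocalLSC_theta
    {γ : Ω → EuclideanSpace ℝ (Fin m) × EuclideanSpace ℝ (Fin d) → ℝ}
    (hγ : IsNormalIntegrand (M.ℱ (t + 1)) γ)
    (hrep : ∀ V : Ω → EuclideanSpace ℝ (Fin d), Measurable[M.ℱ t] V →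
      ∀ᵐ ω ∂P, M.minCost ξ (t + 1) V ω = ((γ ω (M.S (t + 1) ω, V ω) : ℝ) : EReal)) :
    IsLocalLSC (M.ℱ t) P (M.theta ξ t) where
  measurable V _ := M.measurable_theta V
  congr_on V W hV hW A hA h := condEssSup_singleton_congr_on (M.ℱ.le t) hA (by
    filter_upwards [hrep V hV, hrep W hW] with ω h1 h2 hωA
    rw [h1, h2, h ω hωA])
  le_liminf V W hV hW hlim := M.theta_le (Measurable.liminf fun n => M.measurable_theta (W n)) (by
    filter_upwards [hrep V hV, ae_all_iff.2 fun n => hrep (W n) (hW n),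
      ae_all_iff.2 fun n => M.minCost_le_theta (ξ := ξ) (W n)] with ω h1 h2 h3
    rw [h1]
    refine (LowerSemicontinuous.coe_le_liminf (hγ.lowerSemicontinuous ω)
      (x := fun n => (M.S (t + 1) ω, W n ω)) (tendsto_const_nhds.prodMk_nhds (hlim ω))).trans ?_
    refine liminf_le_liminf (Eventually.of_forall fun n => ?_)
    exact (h2 n).symm.trans_le (h3 n))

theorem minCost_congr_on (ht : t < M.T)
    (hfin : ∀ Z : Ω → EuclideanSpace ℝ (Fin d), Measurable[M.ℱ t] Z →
      ∀ᵐ ω ∂P, ∃ r : ℝ, M.minCost ξ (t + 1) Z ω = r)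
    (V W : Ω → EuclideanSpace ℝ (Fin d)) (hV : Measurable[M.ℱ t] V) (hW : Measurable[M.ℱ t] W)
    (A : Set Ω) (hA : MeasurableSet[M.ℱ t] A) (h : ∀ ω ∈ A, V ω = W ω) :
    ∀ᵐ ω ∂P, ω ∈ A → M.minCost ξ t V ω = M.minCost ξ t W ω := by
  have key : ∀ V W : Ω → EuclideanSpace ℝ (Fin d), Measurable[M.ℱ t] V → Measurable[M.ℱ t] W →
      (∀ ω ∈ A, V ω = W ω) → ∀ᵐ ω ∂P, ω ∈ A → M.minCost ξ t V ω ≤ M.minCost ξ t W ω := by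
    intro V W hV hW h
    refine (M.isCondEssInf_minCost ht hW hfin).le_on (M.measurable_minCost V) hA ?_
    rintro _ ⟨Z, hZ, rfl⟩
    filter_upwards [(M.isCondEssInf_minCost ht hV hfin).le _ ⟨Z, hZ, rfl⟩] with ω h1 hωA
    refine h1.trans_eq ?_
    simp only [D, h ω hωA]
  filter_upwards [key V W hV hW h, key W V hW hV fun ω hω => (h ω hω).symm] with ω h1 h2 hωA
  exact (h1 hωA).antisymm (h2 hωA)

/-- The cash component of `Z` is removed because coercivity controls only the risky part. -/
theorem exists_D_lt (ht : t < M.T) (hθ : IsLocalLSC (M.ℱ t) P (M.theta ξ t))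
    (hfin : ∀ Z : Ω → EuclideanSpace ℝ (Fin d), Measurable[M.ℱ t] Z →
      ∀ᵐ ω ∂P, ∃ r : ℝ, M.minCost ξ (t + 1) Z ω = r)
    {V : Ω → EuclideanSpace ℝ (Fin d)} (hV : Measurable[M.ℱ t] V) (q : EReal) :
    ∃ Z : Ω → EuclideanSpace ℝ (Fin d), Measurable[M.ℱ t] Z ∧
      ∀ᵐ ω ∂P, M.minCost ξ t V ω < q → M.D ξ t V (fun ω => dropCash (Z ω)) ω < q := by
  have hY := M.isCondEssInf_minCost ht hV hfin
  rw [image_eq_range] at hY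
  have : Nonempty {Z : Ω → EuclideanSpace ℝ (Fin d) | Measurable[M.ℱ t] Z} :=
    ⟨⟨fun _ => 0, measurable_const⟩⟩
  obtain ⟨⟨Z, hZ⟩, h⟩ := exists_lt_of_isCondEssInf (M.ℱ.le t) (q := fun _ => q)
    (fun i => M.measurable_D ht.le hV i.2) (fun u N hN =>
      ⟨⟨fun ω => (u (N ω)).1 ω, Measurable.comp_index (fun n => (u n).2) hN⟩, by
        filter_upwards [hθ.comp_index (fun n => (u n).2) hN] with ω hω
        simp only [D, hω]⟩) hY measurable_const
  exact ⟨Z, hZ, by rwa [M.D_dropCash ht]⟩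

/-- The compactness step: near-optimal positions for `W n` stay bounded by coercivity, and `D` is
lower semicontinuous jointly in both positions. It serves both lower semicontinuity and the
exclusion of `-∞`. -/
theorem exists_D_le_of_tendsto (ht : t < M.T) (hθ : IsLocalLSC (M.ℱ t) P (M.theta ξ t))
    (hfin : ∀ Z : Ω → EuclideanSpace ℝ (Fin d), Measurable[M.ℱ t] Z →
      ∀ᵐ ω ∂P, ∃ r : ℝ, M.minCost ξ (t + 1) Z ω = r)
    {k : EuclideanSpace ℝ (Fin m) × EuclideanSpace ℝ (Fin d) → ℝ} {c : Ω → ℝ} (hk : Continuous k)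
    (hc : ∀ᵐ ω ∂P, 0 < c ω)
    (hcoer : ∀ W Z : Ω → EuclideanSpace ℝ (Fin d), Measurable[M.ℱ t] Z →
      ∀ᵐ ω ∂P, 1 ≤ ‖dropCash (Z ω)‖ →
        ((‖dropCash (Z ω)‖ * c ω - k (M.S t ω, dropCash (W ω)) : ℝ) : EReal) ≤ M.D ξ t W Z ω)
    {V : Ω → EuclideanSpace ℝ (Fin d)} {W : ℕ → Ω → EuclideanSpace ℝ (Fin d)}
    (hW : ∀ n, Measurable[M.ℱ t] (W n))
    (hlim : ∀ ω, Tendsto (fun n => W n ω) atTop (𝓝 (V ω)))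
    {q : ℕ → EReal} {q' : EReal} {b : ℝ} (hq : Tendsto q atTop (𝓝 q')) (hqb : ∀ n, q n ≤ b)
    {A : Set Ω} (hA : MeasurableSet[M.ℱ t] A)
    (hlt : ∀ n, ∀ᵐ ω ∂P, ω ∈ A → M.minCost ξ t (W n) ω < q n) :
    ∃ Z : Ω → EuclideanSpace ℝ (Fin d), Measurable[M.ℱ t] Z ∧
      ∀ᵐ ω ∂P, ω ∈ A → M.D ξ t V Z ω ≤ q' := by
  classical
  choose Z₀ hZ₀ hZ₀lt using fun n => M.exists_D_lt ht hθ hfin (hW n) (q n)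
  let Z₁ : ℕ → Ω → EuclideanSpace ℝ (Fin d) := fun n ω => dropCash (Z₀ n ω)
  have hZ₁ : ∀ n, Measurable[M.ℱ t] (Z₁ n) := fun n => continuous_dropCash.measurable.comp (hZ₀ n)
  -- Stating boundedness with integer bounds makes `B` measurable although nothing is known about
  -- the measurability of `c`.
  let B : Set Ω := A ∩ ⋃ N : ℕ, ⋂ n, {ω | ‖Z₁ n ω‖ ≤ N}
  have hnorm : ∀ n, Measurable[M.ℱ t] fun ω => ‖Z₁ n ω‖ := fun n =>
    continuous_norm.measurable.comp (hZ₁ n)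
  have hnle : ∀ n (N : ℕ), MeasurableSet[M.ℱ t] {ω | ‖Z₁ n ω‖ ≤ N} := fun n N =>
    measurableSet_le (hnorm n) measurable_const
  have hB : MeasurableSet[M.ℱ t] B := MeasurableSet.inter hA (MeasurableSet.iUnion fun N =>
    MeasurableSet.iInter fun n => hnle n N)
  have hAB : ∀ᵐ ω ∂P, ω ∈ A → ω ∈ B := by
    filter_upwards [hc, ae_all_iff.2 hlt, ae_all_iff.2 hZ₀lt,
      ae_all_iff.2 fun n => hcoer (W n) (Z₁ n) (hZ₁ n)] with ω h1 h2 h3 h4 hωA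
    refine ⟨hωA, ?_⟩
    have h5 : Tendsto (fun n => k (M.S t ω, dropCash (W n ω))) atTop
        (𝓝 (k (M.S t ω, dropCash (V ω)))) :=
      (hk.tendsto _).comp (tendsto_const_nhds.prodMk_nhds
        ((continuous_dropCash.tendsto _).comp (hlim ω)))
    obtain ⟨κ, hκ⟩ := h5.bddAbove_range
    -- Solving `‖Z‖ c - κ ≤ b` gives the second term; the `1` covers positions where coercivity says
    -- nothing.
    refine mem_iUnion.2 ⟨⌈max 1 ((b + κ) / c ω)⌉₊, mem_iInter.2 fun n => ?_⟩
    change ‖Z₁ n ω‖ ≤ _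
    refine le_trans ?_ (Nat.le_ceil _)
    by_cases h6 : 1 ≤ ‖Z₁ n ω‖
    · refine le_max_of_le_right ?_
      have h7 : dropCash (Z₁ n ω) = Z₁ n ω := dropCash_dropCash _
      have h8 := h4 n
      rw [h7] at h8
      have h9 := (h8 h6).trans ((h3 n (h2 n hωA)).le.trans (hqb n))
      rw [EReal.coe_le_coe_iff] at h9
      have h10 : k (M.S t ω, dropCash (W n ω)) ≤ κ := hκ ⟨n, rfl⟩
      rw [le_div_iff₀ h1]
      linarith
    · exact le_max_of_le_left (not_le.1 h6).le
  -- The extraction lemma asks for boundedness at every `ω`, hence the value `0` off `B`.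
  let Z₂ : ℕ → Ω → EuclideanSpace ℝ (Fin d) := fun n ω => if ω ∈ B then Z₁ n ω else 0
  have hZ₂ : ∀ n, Measurable[M.ℱ t] (Z₂ n) := fun n => Measurable.ite hB (hZ₁ n) measurable_const
  obtain ⟨N, Z, hN, hNle, hZ, hZlim⟩ := exists_measurable_subseq_of_bounded hZ₂ (by
    intro ω
    by_cases hω : ω ∈ B
    · obtain ⟨R, hR⟩ := mem_iUnion.1 hω.2
      exact ⟨R, fun n => by simp only [Z₂, if_pos hω]; exact mem_iInter.1 hR n⟩
    · exact ⟨0, fun n => by simp [Z₂, hω]⟩)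
  have hNtop : ∀ ω, Tendsto (fun k => N k ω) atTop atTop := fun ω =>
    tendsto_atTop_mono (fun k => hNle k ω) tendsto_id
  refine ⟨Z, hZ, ?_⟩
  filter_upwards [hθ.le_liminf Z _ hZ (fun k => Measurable.comp_index hZ₂ (hN k)) hZlim,
    ae_all_iff.2 fun k => hθ.comp_index hZ₂ (hN k),
    ae_all_iff.2 fun n => hθ.congr_on (Z₂ n) (Z₁ n) (hZ₂ n) (hZ₁ n) B hB fun ω hω => if_pos hω,
    ae_all_iff.2 hlt, ae_all_iff.2 hZ₀lt, hAB] with ω h1 h2 h3 h4 h5 h6 hωA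
  have hωB := h6 hωA
  have hC := LowerSemicontinuous.coe_le_liminf ((M.C_normal t ht.le).lowerSemicontinuous ω)
    (x := fun k => (M.S t ω, dropCash (Z₂ (N k ω) ω - W (N k ω) ω)))
    (tendsto_const_nhds.prodMk_nhds ((continuous_dropCash.tendsto _).comp
      ((hZlim ω).sub ((hlim ω).comp (hNtop ω)))))
  refine (add_le_add hC h1).trans (EReal.le_liminf_add.trans ?_)
  rw [← (hq.comp (hNtop ω)).liminf_eq]
  refine liminf_le_liminf (Eventually.of_forall fun k => ?_)
  have h7 := (h5 (N k ω) (h4 (N k ω) hωA)).le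
  have h8 : Z₂ (N k ω) ω = Z₁ (N k ω) ω := if_pos hωB
  simp only [Pi.add_apply, h2 k, h3 (N k ω) hωB, h8]
  exact h7

theorem isLocalLSC_minCost (ht : t < M.T) (hθ : IsLocalLSC (M.ℱ t) P (M.theta ξ t))
    (hfin : ∀ Z : Ω → EuclideanSpace ℝ (Fin d), Measurable[M.ℱ t] Z →
      ∀ᵐ ω ∂P, ∃ r : ℝ, M.minCost ξ (t + 1) Z ω = r)
    {k : EuclideanSpace ℝ (Fin m) × EuclideanSpace ℝ (Fin d) → ℝ} {c : Ω → ℝ} (hk : Continuous k)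
    (hc : ∀ᵐ ω ∂P, 0 < c ω)
    (hcoer : ∀ W Z : Ω → EuclideanSpace ℝ (Fin d), Measurable[M.ℱ t] Z →
      ∀ᵐ ω ∂P, 1 ≤ ‖dropCash (Z ω)‖ →
        ((‖dropCash (Z ω)‖ * c ω - k (M.S t ω, dropCash (W ω)) : ℝ) : EReal) ≤
          M.D ξ t W Z ω) : IsLocalLSC (M.ℱ t) P (M.minCost ξ t) where
  measurable V _ := M.measurable_minCost V
  congr_on := M.minCost_congr_on ht hfin
  le_liminf V W hV hW hlim := by
    have hm : Measurable[M.ℱ t] fun ω => liminf (fun n => M.minCost ξ t (W n) ω) atTop :=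
      Measurable.liminf fun n => M.measurable_minCost (W n)
    have hlt : ∀ r : ℚ, ∀ᵐ ω ∂P,
        liminf (fun n => M.minCost ξ t (W n) ω) atTop < ((r : ℝ) : EReal) →
          M.minCost ξ t V ω ≤ ((r : ℝ) : EReal) := by
      intro r
      -- Where the liminf is below `r`, infinitely many `γ_t(W n)` are; a random subsequence keeps
      -- only those, so a constant threshold suffices.
      obtain ⟨N, hN, hNle, hNlt⟩ := exists_measurable_index
        (p := fun n ω => M.minCost ξ t (W n) ω < ((r : ℝ) : EReal))
        fun n => measurableSet_lt (M.measurable_minCost (W n)) measurable_const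
      obtain ⟨Z, hZ, hZle⟩ := M.exists_D_le_of_tendsto ht hθ hfin hk hc hcoer (V := V)
        (W := fun k ω => W (N k ω) ω) (fun k => Measurable.comp_index hW (hN k))
        (fun ω => (hlim ω).comp (tendsto_atTop_mono (fun k => hNle k ω) tendsto_id))
        (q := fun _ => ((r : ℝ) : EReal)) tendsto_const_nhds (fun _ => le_rfl)
        (measurableSet_lt hm measurable_const) (fun k => by
          filter_upwards [ae_eq_comp_index_of_congr_on (M.minCost_congr_on ht hfin) hW (hN k)]
            with ω h1 h2
          rw [h1]
          exact hNlt ω (frequently_lt_of_liminf_lt (by isBoundedDefault) h2) k)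
      filter_upwards [hZle, (M.isCondEssInf_minCost ht hV hfin).le _ ⟨Z, hZ, rfl⟩] with ω h1 h2 h3
      exact h2.trans (h1 h3)
    filter_upwards [ae_all_iff.2 hlt] with ω h1
    refine le_of_forall_gt_imp_ge_of_dense fun y hy => ?_
    obtain ⟨r, hr1, hr2⟩ := EReal.lt_iff_exists_rat_btwn.1 hy
    exact (h1 r hr1).trans hr2.le

/-- The compactness step with the constant sequence `V` and thresholds `-n` would yield some `Z`
with `D = -∞` on `{γ_t(V) = -∞}`. This is impossible, as `C_t` is real and `θ_t(Z)` dominates the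
finite `γ_{t+1}(Z)`. -/
theorem bot_lt_minCost (ht : t < M.T) (hθ : IsLocalLSC (M.ℱ t) P (M.theta ξ t))
    (hfin : ∀ Z : Ω → EuclideanSpace ℝ (Fin d), Measurable[M.ℱ t] Z →
      ∀ᵐ ω ∂P, ∃ r : ℝ, M.minCost ξ (t + 1) Z ω = r)
    {k : EuclideanSpace ℝ (Fin m) × EuclideanSpace ℝ (Fin d) → ℝ} {c : Ω → ℝ} (hk : Continuous k)
    (hc : ∀ᵐ ω ∂P, 0 < c ω)
    (hcoer : ∀ W Z : Ω → EuclideanSpace ℝ (Fin d), Measurable[M.ℱ t] Z →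
      ∀ᵐ ω ∂P, 1 ≤ ‖dropCash (Z ω)‖ →
        ((‖dropCash (Z ω)‖ * c ω - k (M.S t ω, dropCash (W ω)) : ℝ) : EReal) ≤ M.D ξ t W Z ω)
    {V : Ω → EuclideanSpace ℝ (Fin d)} (hV : Measurable[M.ℱ t] V) :
    ∀ᵐ ω ∂P, ⊥ < M.minCost ξ t V ω := by
  have hq : Tendsto (fun n : ℕ => ((-(n : ℝ) : ℝ) : EReal)) atTop (𝓝 ⊥) :=
    (EReal.tendsto_coe_nhds_bot_iff).2 (tendsto_neg_atTop_atBot.comp tendsto_natCast_atTop_atTop)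
  obtain ⟨Z, hZ, hle⟩ := M.exists_D_le_of_tendsto ht hθ hfin hk hc hcoer (W := fun _ => V)
    (fun _ => hV) (fun _ => tendsto_const_nhds) hq (b := 0)
    (fun n => EReal.coe_le_coe_iff.2 (neg_nonpos.2 n.cast_nonneg))
    (A := M.minCost ξ t V ⁻¹' {⊥}) (M.measurable_minCost V (measurableSet_singleton _))
    (fun n => Eventually.of_forall fun ω (hω : _ = _) => by
      rw [hω]
      exact EReal.bot_lt_coe _)
  filter_upwards [hle, hfin Z hZ, M.minCost_le_theta (ξ := ξ) Z] with ω h1 ⟨r, hr⟩ h3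
  refine bot_lt_iff_ne_bot.2 fun h4 => ?_
  have h5 := le_bot_iff.1 (h1 h4)
  rw [D, EReal.add_eq_bot_iff] at h5
  rcases h5 with h5 | h5
  · exact EReal.coe_ne_bot _ h5
  · rw [hr, h5] at h3
    exact EReal.coe_ne_bot _ (le_bot_iff.1 h3)

end CostMarket

/-! ### Conclusion -/

theorem mainTheorem3 {Ω : Type*} [MeasurableSpace Ω] {P : Measure Ω} [IsProbabilityMeasure P]
    {m d : ℕ} [NeZero d] (M : CostMarket Ω P m d) (ξ : Ω → EuclideanSpace ℝ (Fin d))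
    (t : ℕ) (ht : t < M.T)
    (δ : ℝ≥0∞ ≃o ℝ≥0∞) (hδ : ∀ u, t ≤ u → u ≤ M.T → M.SuperHomogeneous δ u)
    (hadd : M.SuperAdditive t ∨ M.SubAdditive t)
    (hξ : M.PayoffAssumption ξ)
    (hsupp : ∀ u, t ≤ u → u < M.T → M.SupportAssumption u)
    (γnext : Ω → EuclideanSpace ℝ (Fin m) × EuclideanSpace ℝ (Fin d) → ℝ)
    (hγnext : IsNormalIntegrand (M.ℱ (t + 1)) γnext)
    (hrep : ∀ V : Ω → EuclideanSpace ℝ (Fin d), Measurable[M.ℱ t] V →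
      ∀ᵐ ω ∂P, M.minCost ξ (t + 1) V ω = ((γnext ω (M.S (t + 1) ω, V ω) : ℝ) : EReal))
    (hpos : ∀ᵐ ω ∂P, 0 < M.sphereInf t ω) :
    ∃ γ : Ω → EuclideanSpace ℝ (Fin m) × EuclideanSpace ℝ (Fin d) → ℝ,
      IsNormalIntegrand (M.ℱ t) γ ∧
      ∀ V : Ω → EuclideanSpace ℝ (Fin d), Measurable[M.ℱ t] V →
        ∀ᵐ ω ∂P, M.minCost ξ t V ω = ((γ ω (M.S t ω, V ω) : ℝ) : EReal) := by
  obtain ⟨⟨g, hg, hg0, hξg⟩, -⟩ := hξ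
  have hξ0 : ∀ ω i, 0 ≤ ξ ω i := fun ω i => by rw [hξg]; exact hg0 _ i
  have hfin : ∀ Z : Ω → EuclideanSpace ℝ (Fin d), Measurable[M.ℱ t] Z →
      ∀ᵐ ω ∂P, ∃ r : ℝ, M.minCost ξ (t + 1) Z ω = r := fun Z hZ =>
    (hrep Z hZ).mono fun ω h => ⟨_, h⟩
  have hθ := M.isLocalLSC_theta hγnext hrep
  obtain ⟨k, c, hk, hc, hcoer⟩ := M.exists_coercive hδ ht hadd hξ0 hpos
  obtain ⟨K, hK, hθK⟩ := M.exists_theta_zero_position_le ht hsupp hg hξg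
  obtain ⟨h, hh, hCh⟩ := M.C_bound t ht.le
  -- The upper bound comes from moving to the zero risky position at date `t`, that is, from `Z = 0`
  -- in the dynamic programming principle.
  have hH : IsNormalIntegrand (M.ℱ t) fun ω (x : EuclideanSpace ℝ (Fin d)) =>
      h (M.S t ω, dropCash (-x)) + K ω := by
    refine ⟨?_, fun ω => Continuous.lowerSemicontinuous ?_⟩
    · refine Measurable.add (hh.measurable.comp (Measurable.prodMk
        ((M.S_measurable t ht.le).comp measurable_fst)
        ((continuous_dropCash.comp continuous_neg).measurable.comp measurable_snd)))
        (hK.comp measurable_fst)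
    · have := continuous_dropCash (d := d)
      fun_prop
  obtain ⟨γ, hγ, hγrep⟩ := (M.isLocalLSC_minCost ht hθ hfin hk hc hcoer).exists_isNormalIntegrand
    (M.ℱ.le t) (fun V hV => M.bot_lt_minCost ht hθ hfin hk hc hcoer hV) hH (by
      intro V hV
      filter_upwards [(M.isCondEssInf_minCost ht hV hfin).le _
        ⟨0, @measurable_const _ _ _ (M.ℱ t) 0, rfl⟩, hθK, M.ae_S_nonneg] with ω h1 h2 h3
      refine h1.trans ?_
      rw [CostMarket.D, EReal.coe_add]
      refine add_le_add (EReal.coe_le_coe_iff.2 ?_) h2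
      rw [Pi.zero_apply, zero_sub]
      exact (le_abs_self _).trans (hCh ω _ (h3 t ht.le) _))
  -- The integrand is constant in the price variable: dependence on the `ℱ_t`-measurable `S_t` is
  -- absorbed into `ω`.
  refine ⟨fun ω p => γ ω p.2, ⟨?_, fun ω => ?_⟩, hγrep⟩
  · exact hγ.measurable.comp (measurable_fst.prodMk (measurable_snd.comp measurable_snd))
  · exact (hγ.lowerSemicontinuous ω).comp continuous_snd
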